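/- **Theorem 3.1 (Profile decomposition).** Let $d\ge 1$ and $0<s<1$. Here $H^s=H^s(\mathbb R^d)$ is the Sobolev space of complex-valued $f\in L^2(\mathbb R^d)$ with $(1+|\xi|^2)^{s/2}\hat f\in L^2$, $\|f\|_{\dot H^s}=\|(-\Delta)^{s/2}f\|_{L^2}$, where $(-\Delta)^{s/2}$ is the Fourier multiplier by $|\xi|^s$, and $\|f\|_{H^s}^2=\|f\|_{L^2}^2+\|f\|_{\dot H^s}^2$. Let $(v_n)_{n\ge1}$ be a bounded sequence in $H^s$. Then there exist a subsequence of $(v_n)_{n\ge1}$ (still denoted $(v_n)_{n\ge1}$), a family $(x_n^j)_{j\ge1}$ of sequences in $\mathbb R^d$, a sequence $(V^j)_{j\ge1}$ of functions in $H^s$ and functions $v_n^l\in H^s$ $(l,n\ge1)$ such that: - for every $k\ne j$, $|x_n^k-x_n^j|\to\infty$ as $n\to\infty$; - for every $l\ge1$, every $n\ge 1$ and every $x\in\mathbb R^d$, $$v_n(x)=\sum_{j=1}^l V^j(x-x_n^j)+v_n^l(x);$$ - for every $q\in(2,2^\star)$, $\ \limsup_{n\to\infty}\|v_n^l\|_{L^q}\to0$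 as $l\to\infty$, where $$2^\star=\begin{cases}\frac{2}{1-2s}&\text{if } d=1,\ s\in(0,\tfrac12),\\ \infty&\text{if } d=1,\ s\in[\tfrac12,1),\\ \frac{2d}{d-2s}&\text{if } d\ge2,\ s\in(0,1);\end{cases}$$ - for every $l\ge1$, as $n\to\infty$, $$\|v_n\|_{L^2}^2=\sum_{j=1}^l\|V^j\|_{L^2}^2+\|v_n^l\|_{L^2}^2+o_n(1),\qquad \|v_n\|_{\dot H^s}^2=\sum_{j=1}^l\|V^j\|_{\dot H^s}^2+\|v_n^l\|_{\dot H^s}^2+o_n(1).$$ -/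

import Mathlib

open MeasureTheory Filter Topology
open scoped ENNReal NNReal FourierTransform SchwartzMap

noncomputable section

/-- Membership in the inhomogeneous Sobolev space `H^s(ℝ^d)`, for complex-valued functions (`s ≥ 0`):
`f` is square integrable and the tempered distribution that it defines is a Sobolev distribution
of order `s` over `L²`, i.e. `(1 + |ξ|²)^{s/2} f̂ ∈ L²`. -/
def MemHs {d : ℕ} (s : ℝ) (f : EuclideanSpace ℝ (Fin d) → ℂ) : Prop :=
  ∃ h : MemLp f 2 (volume : Measure (EuclideanSpace ℝ (Fin d))),
    TemperedDistribution.MemSobolev s 2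
      ((h.toLp f : Lp ℂ 2 (volume : Measure (EuclideanSpace ℝ (Fin d)))) :
        𝓢'(EuclideanSpace ℝ (Fin d), ℂ))

open Classical in
/-- The homogeneous norm `‖f‖_{Ḣ^s} = ‖(-Δ)^{s/2} f‖_{L²}` of a square integrable function, where
`(-Δ)^{s/2}` is the Fourier multiplier by `|ξ|^s`. Mathlib's Fourier transform has the kernel
`e^{-2πi⟨x, ξ⟩}`, for which the symbol reads `(2π|ξ|)^s`; the `L²` norm is taken on the Fourier side
by Plancherel. The value is `∞` if `f` is not in `L²` or not in `H^s`. -/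
def homSobolevNorm {d : ℕ} (s : ℝ) (f : EuclideanSpace ℝ (Fin d) → ℂ) : ℝ≥0∞ :=
  if h : MemLp f 2 (volume : Measure (EuclideanSpace ℝ (Fin d))) then
    eLpNorm (fun ξ : EuclideanSpace ℝ (Fin d) =>
      (((2 * Real.pi * ‖ξ‖) ^ s : ℝ) : ℂ) *
        (𝓕 (h.toLp f) : Lp ℂ 2 (volume : Measure (EuclideanSpace ℝ (Fin d)))) ξ) 2 volume
  else ∞

/-- The norm of `H^s(ℝ^d)`: `‖f‖_{H^s}² = ‖f‖_{L²}² + ‖f‖_{Ḣ^s}²`. -/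
def sobolevNorm {d : ℕ} (s : ℝ) (f : EuclideanSpace ℝ (Fin d) → ℂ) : ℝ≥0∞ :=
  (eLpNorm f 2 volume ^ 2 + homSobolevNorm s f ^ 2) ^ (1 / 2 : ℝ)

/-- The critical Sobolev exponent `2^⋆` for `d ≥ 1` and `0 < s < 1`. -/
def twoStar (d : ℕ) (s : ℝ) : ℝ≥0∞ :=
  if d = 1 then
    if s < 1 / 2 then ENNReal.ofReal (2 / (1 - 2 * s)) else ∞
  else ENNReal.ofReal (2 * d / (d - 2 * s))

end

/-! On the Fourier side a function in `H^s` is `(1 + |ξ|²)^{-s/2} g` with `g ∈ L²`. Translations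
become multiplications by phases: these are unitary, commute with every Fourier multiplier, and have
matrix coefficients vanishing at infinity by Riemann-Lebesgue (`phaseDislocation`).

The profiles are extracted in an abstract Hilbert space (`Dislocation.exists_profiles`). Along an
ultrafilter every translate of the bounded sequence has a weak limit. Choose greedily a translation
sequence divergent from the earlier ones whose weak limit has at least half of the largest possible
norm. Expanding squares splits `‖A v‖²` for every bounded `A` commuting with translations, so the
profile norms are square summable and tend to zero. By the greedy choice, the coefficients of the
remainders against all translates of a fixed vector then become uniformly small.

For smallness in `L^q`, the piece of the function in a dyadic annulus is, as a function of `x`, the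
coefficient of `g` against the `x`-translate of a fixed `L²` vector. Its sup norm is therefore small
for late remainders, and its `L²` norm carries the Sobolev decay. Interpolation
(`eLpNorm_le_rpow_mul_rpow`) and Bernstein give geometrically summable bounds exactly in the
subcritical range, and dominated convergence over the annuli concludes
(`tendsto_limsup_eLpNorm_besselLp`). Only countably many limits are involved, so one subsequence
realizes them all. -/

/-! ### Ultrafilter limits, subsequences and recursive choice -/

section Diagonal

/-- Countably many limits along one ultrafilter finer than `atTop` hold along a common
subsequence. -/
theorem exists_strictMono_tendsto_of_ultrafilter {ι : Type*} [Countable ι] {α : ι → Type*}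
    (𝒰 : Ultrafilter ℕ) (h𝒰 : (𝒰 : Filter ℕ) ≤ atTop) (f : ∀ i, ℕ → α i) (F : ∀ i, Filter (α i))
    (hF : ∀ i, (F i).IsCountablyGenerated) (h : ∀ i, Tendsto (f i) 𝒰 (F i)) :
    ∃ φ : ℕ → ℕ, StrictMono φ ∧ ∀ i, Tendsto (fun n => f i (φ n)) atTop (F i) := by
  -- The coarsest filter encoding all the limits is countably generated, unlike `𝒰`, so a sequence
  -- tends to it.
  let G : Filter ℕ := atTop ⊓ ⨅ i, comap (f i) (F i)
  have hG : (𝒰 : Filter ℕ) ≤ G := le_inf h𝒰 (le_iInf fun i => (h i).le_comap)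
  have : G.NeBot := neBot_of_le hG
  obtain ⟨u, hu⟩ := exists_seq_tendsto G
  obtain ⟨ψ, hψ, hφ⟩ := strictMono_subseq_of_tendsto_atTop (hu.mono_right inf_le_left)
  refine ⟨u ∘ ψ, hφ, fun i => ?_⟩
  have h2 : Tendsto u atTop (comap (f i) (F i)) :=
    hu.mono_right (inf_le_right.trans (iInf_le _ i))
  exact (tendsto_comap_iff.1 h2).comp hψ.tendsto_atTop

/-- A real sequence with bounded range converges along every ultrafilter. -/
theorem Ultrafilter.exists_tendsto_of_mem_Icc (𝒰 : Ultrafilter ℕ) {u : ℕ → ℝ} {a b : ℝ}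
    (h : ∀ n, u n ∈ Set.Icc a b) : ∃ c, Tendsto u 𝒰 (𝓝 c) := by
  obtain ⟨c, -, hc⟩ := (isCompact_Icc (a := a) (b := b)).ultrafilter_le_nhds (𝒰.map u)
    (by
      rw [Ultrafilter.coe_map, le_principal_iff, Filter.mem_map]
      exact univ_mem' h)
  exact ⟨c, hc⟩

/-- Recursive choice, where each term may depend on the set of all previous ones. -/
theorem exists_seq_of_forall_list {α : Type*} {Q : List α → α → Prop} (h : ∀ s, ∃ y, Q s y) :
    ∃ (f : ℕ → α) (g : ℕ → List α), (∀ n a, a ∈ g n ↔ ∃ j < n, f j = a) ∧ ∀ n, Q (g n) (f n) := by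
  choose c hc using h
  let g : ℕ → List α := fun n => n.rec [] fun _ s => c s :: s
  refine ⟨fun n => c (g n), g, fun n a => ?_, fun n => hc _⟩
  induction n with
  | zero => simp [g]
  | succ n ih =>
    have : g (n + 1) = c (g n) :: g n := rfl
    rw [this, List.mem_cons, ih]
    constructor
    · rintro (rfl | ⟨j, hj, rfl⟩)
      · exact ⟨n, by lia, rfl⟩
      · exact ⟨j, by lia, rfl⟩
    · rintro ⟨j, hj, rfl⟩
      rcases Nat.lt_succ_iff_lt_or_eq.1 hj with hj | rfl
      · exact Or.inr ⟨j, hj, rfl⟩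
      · exact Or.inl rfl

end Diagonal

/-! ### Profile decomposition in a Hilbert space -/

section Abstract

variable {E H : Type*} [NormedAddCommGroup E] [NormedAddCommGroup H] [InnerProductSpace ℂ H]

local notation "⟪" x ", " y "⟫" => inner ℂ x y

/-- Weak convergence of a sequence in a Hilbert space along a filter. -/
def WeakTendsto (u : ℕ → H) (l : Filter ℕ) (a : H) : Prop :=
  ∀ b, Tendsto (fun n => ⟪b, u n⟫) l (𝓝 ⟪b, a⟫)

namespace WeakTendsto

variable {u w : ℕ → H} {l : Filter ℕ} {a b : H}

theorem sub (hu : WeakTendsto u l a) (hw : WeakTendsto w l b) :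
    WeakTendsto (fun n => u n - w n) l (a - b) := fun c => by
  simpa only [inner_sub_right] using (hu c).sub (hw c)

theorem sum {ι : Type*} {s : Finset ι} {u : ι → ℕ → H} {a : ι → H}
    (h : ∀ i ∈ s, WeakTendsto (u i) l (a i)) :
    WeakTendsto (fun n => ∑ i ∈ s, u i n) l (∑ i ∈ s, a i) := fun c => by
  simpa only [inner_sum] using tendsto_finsetSum s fun i hi => h i hi c

theorem norm_le [l.NeBot] (hu : WeakTendsto u l a) {C : ℝ} (hC : ∀ n, ‖u n‖ ≤ C) : ‖a‖ ≤ C := by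
  have h1 : Tendsto (fun n => ‖⟪a, u n⟫‖) l (𝓝 (‖a‖ * ‖a‖)) := by
    have := (hu a).norm
    rwa [inner_self_eq_norm_sq_to_K, norm_pow, RCLike.norm_ofReal, abs_norm, sq] at this
  have h2 : ‖a‖ * ‖a‖ ≤ ‖a‖ * C := le_of_tendsto h1 <| Eventually.of_forall fun n =>
    (norm_inner_le_norm _ _).trans (by gcongr; exact hC n)
  rcases (norm_nonneg a).eq_or_lt with h | h
  · rw [← h]; exact (norm_nonneg _).trans (hC 0)
  · exact le_of_mul_le_mul_left h2 h

/-- Banach-Alaoglu through the Riesz isomorphism, which is conjugate-linear; hence the conjugations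
in the proof. -/
theorem exists_of_bounded [CompleteSpace H] (𝒰 : Ultrafilter ℕ) {C : ℝ} (hC : ∀ n, ‖u n‖ ≤ C) :
    ∃ a, WeakTendsto u 𝒰 a := by
  let T : ℕ → WeakDual ℂ H := fun n => StrongDual.toWeakDual (InnerProductSpace.toDual ℂ H (u n))
  obtain ⟨ℓ, -, hℓ⟩ := (WeakDual.isCompact_closedBall (𝕜 := ℂ) (0 : StrongDual ℂ H)
    C).ultrafilter_le_nhds (𝒰.map T) (by
      simp only [Ultrafilter.coe_map, le_principal_iff, mem_map]
      refine univ_mem' fun n => ?_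
      simpa [T] using hC n)
  refine ⟨(InnerProductSpace.toDual ℂ H).symm (WeakDual.toStrongDual ℓ), fun b => ?_⟩
  have h1 : Tendsto (fun n => T n b) 𝒰 (𝓝 (ℓ b)) :=
    ((WeakDual.eval_continuous b).tendsto ℓ).comp hℓ
  have h2 : Tendsto (fun n => starRingEnd ℂ (T n b)) 𝒰 (𝓝 (starRingEnd ℂ (ℓ b))) :=
    (Complex.continuous_conj.tendsto _).comp h1
  convert h2 using 2
  · simp [T]
  · rw [← inner_conj_symm, InnerProductSpace.toDual_symm_apply]; rfl

end WeakTendsto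

variable (E H) in
/-- A strongly continuous unitary representation of `E` whose matrix coefficients vanish at
infinity. -/
structure Dislocation where
  /-- The unitary operators. -/
  toFun : E → H →L[ℂ] H
  map_zero : ∀ a, toFun 0 a = a
  map_add : ∀ x y a, toFun (x + y) a = toFun x (toFun y a)
  inner_left : ∀ x a b, ⟪toFun x a, b⟫ = ⟪a, toFun (-x) b⟫
  continuous : ∀ a, Continuous fun x => toFun x a
  tendsto_zero : ∀ a b, Tendsto (fun x => ⟪toFun x a, b⟫) (Bornology.cobounded E) (𝓝 0)

namespace Dislocation

variable (U : Dislocation E H)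

instance : CoeFun (Dislocation E H) fun _ => E → H →L[ℂ] H := ⟨Dislocation.toFun⟩

theorem neg_apply_apply (x : E) (a : H) : U (-x) (U x a) = a := by
  rw [← U.map_add, neg_add_cancel, U.map_zero]

theorem norm_apply (x : E) (a : H) : ‖U x a‖ = ‖a‖ := by
  rw [@norm_eq_sqrt_re_inner ℂ, @norm_eq_sqrt_re_inner ℂ _ _ _ _ a, U.inner_left, neg_apply_apply]

theorem inner_right (x : E) (a b : H) : ⟪a, U x b⟫ = ⟪U (-x) a, b⟫ := by
  rw [U.inner_left, neg_neg]

/-- Moving the operators onto the test vector turns strong continuity into norm convergence there;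
boundedness of `u` absorbs the error. -/
theorem weakTendsto_of_tendsto {l : Filter ℕ} {y : ℕ → E} {y₀ : E} (hy : Tendsto y l (𝓝 y₀))
    {u : ℕ → H} {C : ℝ} (hC : ∀ n, ‖u n‖ ≤ C) {a : H} (hu : WeakTendsto u l a) :
    WeakTendsto (fun n => U (y n) (u n)) l (U y₀ a) := fun b => by
  have h1 : Tendsto (fun n => ⟪U (-(y n)) b - U (-y₀) b, u n⟫) l (𝓝 0) := by
    refine squeeze_zero_norm (a := fun n => ‖U (-(y n)) b - U (-y₀) b‖ * C)
      (fun n => (norm_inner_le_norm _ _).trans (by gcongr; exact hC n)) ?_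
    have h2 : Tendsto (fun n => U (-(y n)) b) l (𝓝 (U (-y₀) b)) :=
      ((U.continuous b).tendsto _).comp hy.neg
    have h3 := ((h2.sub_const (U (-y₀) b)).norm).mul_const C
    simpa using h3
  have h4 := h1.add (hu (U (-y₀) b))
  simpa only [inner_sub_left, sub_add_cancel, zero_add, ← U.inner_right] using h4

theorem weakTendsto_zero {l : Filter ℕ} {y : ℕ → E} (hy : Tendsto (fun n => ‖y n‖) l atTop)
    (a : H) : WeakTendsto (fun n => U (y n) a) l 0 := fun b => by
  have h1 : Tendsto y l (Bornology.cobounded E) := tendsto_norm_atTop_iff_cobounded.1 hy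
  have h2 := ((U.tendsto_zero a b).comp h1)
  have h3 := (Complex.continuous_conj.tendsto _).comp h2
  simpa [Function.comp_def] using h3

/-- Two sequences diverge from each other along a filter. -/
def Diverge (l : Filter ℕ) (x y : ℕ → E) : Prop := Tendsto (fun n => ‖x n - y n‖) l atTop

theorem Diverge.symm {l : Filter ℕ} {x y : ℕ → E} (h : Diverge l x y) : Diverge l y x := by
  simpa only [Diverge, norm_sub_rev] using h

theorem exists_diverge [NormedSpace ℝ E] [Nontrivial E] {l : Filter ℕ} (hl : l ≤ atTop)
    (s : List (ℕ → E)) : ∃ y, ∀ z ∈ s, Diverge l z y := by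
  obtain ⟨e, he⟩ := exists_norm_eq E (zero_le_one (α := ℝ))
  -- The length exceeds each `‖z n‖` by at least `n`, so the reverse triangle inequality applies.
  refine ⟨fun n => ((n : ℝ) + (s.map fun z => ‖z n‖).sum) • e, fun z hz => ?_⟩
  refine tendsto_atTop_mono (fun n => ?_) (tendsto_natCast_atTop_atTop.mono_left hl)
  have h1 : ‖z n‖ ≤ (s.map fun z => ‖z n‖).sum :=
    List.single_le_sum (by simp) _ (List.mem_map_of_mem hz)
  rw [norm_sub_rev]
  refine le_trans ?_ (norm_sub_norm_le _ _)
  rw [norm_smul, he, mul_one, Real.norm_of_nonneg]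
  · linarith
  · exact add_nonneg n.cast_nonneg ((norm_nonneg _).trans h1)

/-- Along an ultrafilter, failing to diverge means being eventually bounded, and closed balls are
compact. -/
theorem tendsto_of_not_diverge [ProperSpace E] {𝒰 : Ultrafilter ℕ} {x y : ℕ → E}
    (h : ¬ Diverge 𝒰 x y) : ∃ z, Tendsto (fun n => x n - y n) 𝒰 (𝓝 z) := by
  simp only [Diverge, tendsto_atTop, not_forall] at h
  obtain ⟨R, hR⟩ := h
  have hR' : ∀ᶠ n in 𝒰, ‖x n - y n‖ ≤ R :=
    (Ultrafilter.eventually_not.2 hR).mono fun n hn => (not_le.1 hn).le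
  obtain ⟨z, -, hz⟩ := (isCompact_closedBall (0 : E) R).ultrafilter_le_nhds
    (𝒰.map fun n => x n - y n) (by
      rw [Ultrafilter.coe_map, le_principal_iff, Filter.mem_map]
      filter_upwards [hR'] with n hn
      simpa using hn)
  exact ⟨z, hz⟩

/-- Expanding the square leaves only a cross term, which is the weak limit tested against `A* A V`.
-/
theorem tendsto_norm_sub_sq {l : Filter ℕ} {A : H →L[ℂ] H} [CompleteSpace H]
    (hA : ∀ x a, A (U x a) = U x (A a)) {w : ℕ → H} {x : ℕ → E} {V : H}
    (hw : WeakTendsto (fun n => U (-x n) (w n)) l V) :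
    Tendsto (fun n => ‖A (w n)‖ ^ 2 - (‖A V‖ ^ 2 + ‖A (w n - U (x n) V)‖ ^ 2)) l (𝓝 0) := by
  have h1 := hw ((ContinuousLinearMap.adjoint A) (A V))
  have h2 : ∀ n, ‖A (w n)‖ ^ 2 - (‖A V‖ ^ 2 + ‖A (w n - U (x n) V)‖ ^ 2) =
      2 * RCLike.re ⟪(ContinuousLinearMap.adjoint A) (A V), U (-x n) (w n)⟫ - 2 * ‖A V‖ ^ 2 := by
    intro n
    rw [map_sub, @norm_sub_sq ℂ, hA, U.norm_apply, ContinuousLinearMap.adjoint_inner_left, hA,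
      ← U.inner_left, ← inner_conj_symm, RCLike.conj_re]
    ring
  simp only [h2]
  have h3 := (((RCLike.continuous_re (K := ℂ)).tendsto _).comp h1).const_mul 2 |>.sub_const
    (2 * ‖A V‖ ^ 2)
  have h4 : RCLike.re ⟪(ContinuousLinearMap.adjoint A) (A V), V⟫ = ‖A V‖ ^ 2 := by
    rw [ContinuousLinearMap.adjoint_inner_left, inner_self_eq_norm_sq]
  rwa [h4, sub_self] at h3

/-- Profile decomposition of a bounded sequence along an ultrafilter. -/
theorem exists_profiles [NormedSpace ℝ E] [Nontrivial E] [ProperSpace E] [CompleteSpace H]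
    {𝒰 : Ultrafilter ℕ} (h𝒰 : (𝒰 : Filter ℕ) ≤ atTop) {v : ℕ → H} {C : ℝ}
    (hC : ∀ n, ‖v n‖ ≤ C) :
    ∃ (x : ℕ → ℕ → E) (V : ℕ → H) (w : ℕ → ℕ → H),
      (∀ l n, w l n = v n - ∑ j ∈ Finset.range l, U (x j n) (V j)) ∧
      (∀ k j, k ≠ j → Tendsto (fun n => ‖x k n - x j n‖) 𝒰 atTop) ∧
      (∀ A : H →L[ℂ] H, (∀ x a, A (U x a) = U x (A a)) → ∀ l,
        Tendsto (fun n => ‖A (v n)‖ ^ 2 -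
          ((∑ j ∈ Finset.range l, ‖A (V j)‖ ^ 2) + ‖A (w l n)‖ ^ 2)) 𝒰 (𝓝 0)) ∧
      (∀ φ : H, ∃ c : ℕ → ℝ,
        (∀ l, Tendsto (fun n => ⨆ y, ‖⟪U y φ, w l n⟫‖) 𝒰 (𝓝 (c l))) ∧
        Tendsto c atTop (𝓝 0)) := by
  have hC' : ∀ (x : ℕ → E) n, ‖U (-x n) (v n)‖ ≤ C := fun x n => by
    rw [U.norm_apply]; exact hC n
  -- The ultrafilter gives weak limits for the uncountably many translation sequences at once, which
  -- no single subsequence need do.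
  choose W hW using fun x : ℕ → E => WeakTendsto.exists_of_bounded 𝒰 (hC' x)
  have hWC : ∀ x, ‖W x‖ ≤ C := fun x => (hW x).norm_le (hC' x)
  -- choice of the translation parameters
  have step : ∀ s : List (ℕ → E), ∃ y, (∀ z ∈ s, Diverge 𝒰 z y) ∧
      ∀ y', (∀ z ∈ s, Diverge 𝒰 z y') → ‖W y'‖ ≤ 2 * ‖W y‖ := by
    intro s
    let S : Set ℝ := {t | ∃ y, (∀ z ∈ s, Diverge 𝒰 z y) ∧ ‖W y‖ = t}
    have hS : BddAbove S := ⟨C, by rintro _ ⟨y, -, rfl⟩; exact hWC y⟩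
    obtain ⟨y₀, hy₀⟩ := exists_diverge h𝒰 s
    -- If the supremum is zero, every admissible sequence is optimal; otherwise some value exceeds
    -- half of it.
    rcases (norm_nonneg (W y₀)).trans (le_csSup hS ⟨y₀, hy₀, rfl⟩) |>.eq_or_lt with h0 | h0
    · refine ⟨y₀, hy₀, fun y' hy' => ?_⟩
      have := le_csSup hS ⟨y', hy', rfl⟩
      rw [← h0] at this
      linarith [norm_nonneg (W y₀)]
    · obtain ⟨_, ⟨y, hy, rfl⟩, hlt⟩ := exists_lt_of_lt_csSup
        (s := S) ⟨_, y₀, hy₀, rfl⟩ (half_lt_self h0)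
      refine ⟨y, hy, fun y' hy' => ?_⟩
      have := le_csSup hS ⟨y', hy', rfl⟩
      linarith
  obtain ⟨x, g, hg, hx⟩ := exists_seq_of_forall_list step
  have hlt : ∀ k j, k < j → Diverge 𝒰 (x k) (x j) := fun k j hkj =>
    (hx j).1 _ ((hg j _).2 ⟨k, hkj, rfl⟩)
  have hne : ∀ k j, k ≠ j → Diverge 𝒰 (x k) (x j) := fun k j hkj =>
    hkj.lt_or_gt.elim (hlt k j) fun h => (hlt j k h).symm
  have hmax : ∀ l y, (∀ j < l, Diverge 𝒰 (x j) y) → ‖W y‖ ≤ 2 * ‖W (x l)‖ := fun l y hy =>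
    (hx l).2 y fun z hz => by obtain ⟨j, hj, rfl⟩ := (hg l z).1 hz; exact hy j hj
  let V : ℕ → H := fun j => W (x j)
  let w : ℕ → ℕ → H := fun l n => v n - ∑ j ∈ Finset.range l, U (x j n) (V j)
  -- weak limits of translated remainders
  have hweak : ∀ (y : ℕ → E) (l : ℕ) (a : ℕ → H),
      (∀ j < l, WeakTendsto (fun n => U (-y n) (U (x j n) (V j))) 𝒰 (a j)) →
      WeakTendsto (fun n => U (-y n) (w l n)) 𝒰 (W y - ∑ j ∈ Finset.range l, a j) := by
    intro y l a ha
    have := (hW y).sub (WeakTendsto.sum (s := Finset.range l) fun j hj => ha j (by simpa using hj))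
    simpa only [w, map_sub, map_sum] using this
  have hdiv : ∀ (y : ℕ → E) (j : ℕ), Diverge 𝒰 (x j) y →
      WeakTendsto (fun n => U (-y n) (U (x j n) (V j))) 𝒰 0 := by
    intro y j h
    have := U.weakTendsto_zero h (V j)
    simpa only [← U.map_add, neg_add_eq_sub] using this
  have hfar : ∀ (y : ℕ → E) (l : ℕ), (∀ j < l, Diverge 𝒰 (x j) y) →
      WeakTendsto (fun n => U (-y n) (w l n)) 𝒰 (W y) := by
    intro y l h
    simpa using hweak y l 0 fun j hj => hdiv y j (h j hj)
  -- Seen from `x j`, the other profiles vanish weakly and profile `j` cancels the limit `W (x j)`.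
  have hself : ∀ l, ∀ j < l, WeakTendsto (fun n => U (-x j n) (w l n)) 𝒰 0 := by
    intro l j hj
    have := hweak (x j) l (fun i => if i = j then V j else 0) fun i hi => by
      split_ifs with h
      · subst h
        intro b
        simp only [U.neg_apply_apply]
        exact tendsto_const_nhds
      · exact hdiv _ _ (hne i j h)
    simpa [hj, V] using this
  have hwC : ∀ l, ∃ M, ∀ n, ‖w l n‖ ≤ M := fun l =>
    ⟨C + ∑ j ∈ Finset.range l, ‖V j‖, fun n => (norm_sub_le _ _).trans
      (add_le_add (hC n) ((norm_sum_le _ _).trans_eq (by simp only [U.norm_apply])))⟩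
  have hpyth : ∀ A : H →L[ℂ] H, (∀ x a, A (U x a) = U x (A a)) → ∀ l,
        Tendsto (fun n => ‖A (v n)‖ ^ 2 -
          ((∑ j ∈ Finset.range l, ‖A (V j)‖ ^ 2) + ‖A (w l n)‖ ^ 2)) 𝒰 (𝓝 0) := by
    intro A hA l
    induction l with
    | zero => simp [w]
    | succ l ih =>
      -- Since `x l` diverges from the earlier parameters, the remainder seen from `x l` still has
      -- weak limit `V l`.
      have h1 := U.tendsto_norm_sub_sq hA (hfar (x l) l fun j hj => hlt j l hj)
      have h2 := ih.add h1
      rw [add_zero] at h2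
      refine h2.congr fun n => ?_
      have h3 : w l n - U (x l n) (W (x l)) = w (l + 1) n := by
        simp only [w, V, Finset.sum_range_succ]; abel
      rw [h3, Finset.sum_range_succ]
      ring
  have hsum : Summable fun j => ‖V j‖ ^ 2 := by
    refine summable_of_sum_range_le (c := C ^ 2) (fun j => sq_nonneg _) fun l => ?_
    have h1 := hpyth (ContinuousLinearMap.id ℂ H) (fun _ _ => rfl) l
    have h2 : ∀ n, ‖v n‖ ^ 2 - ((∑ j ∈ Finset.range l, ‖V j‖ ^ 2) + ‖w l n‖ ^ 2) ≤
        C ^ 2 - ∑ j ∈ Finset.range l, ‖V j‖ ^ 2 := fun n => by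
      have : ‖v n‖ ^ 2 ≤ C ^ 2 := by gcongr; exact hC n
      linarith [sq_nonneg ‖w l n‖]
    linarith [le_of_tendsto h1 (Eventually.of_forall h2)]
  have hV : Tendsto (fun j => ‖V j‖) atTop (𝓝 0) := by
    have := (hsum.tendsto_atTop_zero).sqrt
    simpa [Real.sqrt_sq (norm_nonneg _)] using this
  refine ⟨x, V, w, fun _ _ => rfl, hne, hpyth, fun φ => ?_⟩
  have hbdd : ∀ l n, BddAbove (Set.range fun y => ‖⟪U y φ, w l n⟫‖) := fun l n =>
    ⟨‖φ‖ * ‖w l n‖, by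
      rintro _ ⟨y, rfl⟩
      exact (norm_inner_le_norm _ _).trans_eq (by rw [U.norm_apply])⟩
  have hlim : ∀ l, ∃ c, Tendsto (fun n => ⨆ y, ‖⟪U y φ, w l n⟫‖) 𝒰 (𝓝 c) := by
    intro l
    obtain ⟨M, hM⟩ := hwC l
    refine 𝒰.exists_tendsto_of_mem_Icc (a := 0) (b := ‖φ‖ * M) fun n =>
      ⟨Real.iSup_nonneg fun y => norm_nonneg _, ciSup_le fun y => ?_⟩
    refine (norm_inner_le_norm _ _).trans ?_
    rw [U.norm_apply]
    gcongr
    exact hM n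
  choose c hc using hlim
  refine ⟨c, hc, ?_⟩
  have hc0 : ∀ l, 0 ≤ c l := fun l => ge_of_tendsto (hc l)
    (Eventually.of_forall fun n => Real.iSup_nonneg fun y => norm_nonneg _)
  have hcV : ∀ l, c l ≤ ‖φ‖ * (2 * ‖V l‖) := by
    intro l
    -- The supremum may not be attained, so it is followed by near-maximizers.
    have h1 : ∀ n : ℕ, ∃ y, (⨆ y, ‖⟪U y φ, w l n⟫‖) - 1 / ((n : ℝ) + 1) < ‖⟪U y φ, w l n⟫‖ :=
      fun n => exists_lt_of_lt_ciSup (sub_lt_self _ (by positivity))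
    choose y hy using h1
    -- Either `y` diverges from all earlier parameters and the greedy choice bounds its weak limit,
    -- or it stays at a convergent distance from some `x j` and the limit is zero.
    have hlimy : ∃ a, ‖a‖ ≤ 2 * ‖V l‖ ∧ WeakTendsto (fun n => U (-y n) (w l n)) 𝒰 a := by
      by_cases h : ∀ j < l, Diverge 𝒰 (x j) y
      · exact ⟨W y, hmax l y h, hfar y l h⟩
      · push Not at h
        obtain ⟨j, hj, hjy⟩ := h
        obtain ⟨z, hz⟩ := tendsto_of_not_diverge hjy
        obtain ⟨M, hM⟩ := hwC l
        have := U.weakTendsto_of_tendsto hz (C := M) (u := fun n => U (-x j n) (w l n))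
          (fun n => by rw [U.norm_apply]; exact hM n) (hself l j hj)
        refine ⟨0, by simp, ?_⟩
        rw [ContinuousLinearMap.map_zero] at this
        convert this using 2 with n
        rw [← U.map_add]
        congr 2
        abel
    obtain ⟨a, ha, hay⟩ := hlimy
    have h2 : Tendsto (fun n => ‖⟪U (y n) φ, w l n⟫‖) 𝒰 (𝓝 ‖⟪φ, a⟫‖) := by
      simpa only [U.inner_left] using (hay φ).norm
    have h3 : Tendsto (fun n : ℕ => (⨆ y, ‖⟪U y φ, w l n⟫‖) - 1 / ((n : ℝ) + 1)) 𝒰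
        (𝓝 (c l - 0)) :=
      (hc l).sub (tendsto_one_div_add_atTop_nhds_zero_nat.mono_left h𝒰)
    rw [sub_zero] at h3
    calc c l ≤ ‖⟪φ, a⟫‖ := le_of_tendsto_of_tendsto' h3 h2 fun n => (hy n).le
      _ ≤ ‖φ‖ * ‖a‖ := norm_inner_le_norm _ _
      _ ≤ _ := by gcongr
  refine squeeze_zero hc0 hcV ?_
  simpa using (hV.const_mul 2).const_mul ‖φ‖

end Dislocation

end Abstract

/-! ### Phases and translations on the Fourier side -/

section Phase

variable {E : Type*} [NormedAddCommGroup E] [InnerProductSpace ℝ E]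

/-- The phase function `ξ ↦ e^{-2πi⟨ξ, x⟩}`. -/
noncomputable def phase (x ξ : E) : ℂ := (Real.fourierChar (-(inner ℝ ξ x)) : ℂ)

theorem continuous_phase (x : E) : Continuous (phase x) := by
  unfold phase
  exact continuous_subtype_val.comp (Real.continuous_fourierChar.comp (by fun_prop))

theorem norm_phase (x ξ : E) : ‖phase x ξ‖ = 1 := Circle.norm_coe _

theorem phase_zero (ξ : E) : phase 0 ξ = 1 := by simp [phase]

theorem phase_add (x y ξ : E) : phase (x + y) ξ = phase x ξ * phase y ξ := by
  simp only [phase, inner_add_right, neg_add, AddChar.map_add_eq_mul, Circle.coe_mul]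

theorem conj_phase (x ξ : E) : (starRingEnd ℂ) (phase x ξ) = phase (-x) ξ := by
  simp [phase, ← Circle.coe_inv_eq_conj, AddChar.map_neg_eq_inv]

end Phase

section Fourier

variable {E : Type*} [NormedAddCommGroup E] [InnerProductSpace ℝ E] [FiniteDimensional ℝ E]
  [MeasurableSpace E] [BorelSpace E]

local notation "⟪" x ", " y "⟫" => inner ℂ x y

/-- Multiplication by a bounded function as an operator on `L²`. -/
noncomputable def mulL2 {m : E → ℂ} (hm : MemLp m ∞ (volume : Measure E)) :
    Lp ℂ 2 (volume : Measure E) →L[ℂ] Lp ℂ 2 (volume : Measure E) :=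
  (ContinuousLinearMap.mul ℂ ℂ).holderL volume ∞ 2 2 (hm.toLp m)

theorem coeFn_mulL2 {m : E → ℂ} (hm : MemLp m ∞ (volume : Measure E))
    (f : Lp ℂ 2 (volume : Measure E)) : mulL2 hm f =ᵐ[volume] fun ξ => m ξ * f ξ := by
  rw [mulL2, ContinuousLinearMap.holderL_apply_apply]
  filter_upwards [(ContinuousLinearMap.mul ℂ ℂ).coeFn_holder (r := 2) (hm.toLp m) f,
    hm.coeFn_toLp] with ξ h1 h2
  rw [h1, h2, ContinuousLinearMap.mul_apply']

theorem mulL2_eq_smul {m : E → ℂ} (hm : MemLp m ∞ (volume : Measure E))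
    (f : Lp ℂ 2 (volume : Measure E)) :
    mulL2 hm f = (hm.toLp m • f : Lp ℂ 2 (volume : Measure E)) := by
  apply Lp.ext
  filter_upwards [coeFn_mulL2 hm f, Lp.coeFn_lpSMul (r := 2) (hm.toLp m) f, hm.coeFn_toLp]
    with ξ h1 h2 h3
  rw [h1, h2, Pi.smul_apply', h3, smul_eq_mul]

theorem mulL2_comm {m m' : E → ℂ} (hm : MemLp m ∞ (volume : Measure E))
    (hm' : MemLp m' ∞ (volume : Measure E)) (f : Lp ℂ 2 (volume : Measure E)) :
    mulL2 hm (mulL2 hm' f) = mulL2 hm' (mulL2 hm f) := by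
  apply Lp.ext
  filter_upwards [coeFn_mulL2 hm f, coeFn_mulL2 hm' f, coeFn_mulL2 hm (mulL2 hm' f),
    coeFn_mulL2 hm' (mulL2 hm f)] with ξ h1 h2 h3 h4
  rw [h3, h4, h1, h2]
  ring

theorem memLp_top_of_norm_le {m : E → ℂ} (hm : Measurable m) {C : ℝ} (hC : ∀ ξ, ‖m ξ‖ ≤ C) :
    MemLp m ∞ (volume : Measure E) :=
  memLp_top_of_bound hm.aestronglyMeasurable C (Eventually.of_forall hC)

theorem memLp_phase (x : E) : MemLp (phase x) ∞ (volume : Measure E) :=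
  memLp_top_of_norm_le (continuous_phase x).measurable fun ξ => (norm_phase x ξ).le

/-- Matrix coefficients are inverse Fourier transforms of `L¹` functions, the source of both their
continuity and their decay. -/
theorem inner_mulL2_phase (x : E) (a b : Lp ℂ 2 (volume : Measure E)) :
    ⟪mulL2 (memLp_phase x) a, b⟫ = 𝓕⁻ (fun ξ => ⟪a ξ, b ξ⟫) x := by
  rw [L2.inner_def, Real.fourierInv_eq]
  refine integral_congr_ae ?_
  filter_upwards [coeFn_mulL2 (memLp_phase x) a] with ξ h
  rw [h, RCLike.inner_apply, map_mul, conj_phase, Circle.smul_def, smul_eq_mul, phase,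
    inner_neg_right, neg_neg, RCLike.inner_apply]
  ring

theorem integrable_inner_L2 (a b : Lp ℂ 2 (volume : Measure E)) :
    Integrable (fun ξ => ⟪a ξ, b ξ⟫) := L2.integrable_inner a b

theorem inner_mulL2_phase_left (x : E) (a b : Lp ℂ 2 (volume : Measure E)) :
    ⟪mulL2 (memLp_phase x) a, b⟫ = ⟪a, mulL2 (memLp_phase (-x)) b⟫ := by
  rw [L2.inner_def, L2.inner_def]
  refine integral_congr_ae ?_
  filter_upwards [coeFn_mulL2 (memLp_phase x) a, coeFn_mulL2 (memLp_phase (-x)) b] with ξ h h'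
  simp only [h, h', RCLike.inner_apply, map_mul, conj_phase]
  ring

theorem mulL2_phase_add (x y : E) (a : Lp ℂ 2 (volume : Measure E)) :
    mulL2 (memLp_phase (x + y)) a = mulL2 (memLp_phase x) (mulL2 (memLp_phase y) a) := by
  apply Lp.ext
  filter_upwards [coeFn_mulL2 (memLp_phase (x + y)) a, coeFn_mulL2 (memLp_phase y) a,
    coeFn_mulL2 (memLp_phase x) (mulL2 (memLp_phase y) a)] with ξ h1 h2 h3
  rw [h1, h3, h2, phase_add, mul_assoc]

theorem mulL2_phase_zero (a : Lp ℂ 2 (volume : Measure E)) :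
    mulL2 (memLp_phase (0 : E)) a = a := by
  apply Lp.ext
  filter_upwards [coeFn_mulL2 (memLp_phase (0 : E)) a] with ξ h1
  rw [h1, phase_zero, one_mul]

theorem continuous_inner_mulL2_phase (a b : Lp ℂ 2 (volume : Measure E)) :
    Continuous fun x => ⟪mulL2 (memLp_phase x) a, b⟫ := by
  simp only [inner_mulL2_phase]
  exact VectorFourier.fourierIntegral_continuous Real.continuous_fourierChar
    (L := -innerₗ E) (by simp only [LinearMap.neg_apply, innerₗ_apply_apply]; fun_prop)
    (integrable_inner_L2 a b)

variable (E) in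
/-- Multiplication by phases, that is, translations seen through the Fourier transform. -/
noncomputable def phaseDislocation : Dislocation E (Lp ℂ 2 (volume : Measure E)) where
  toFun x := mulL2 (memLp_phase x)
  map_zero := mulL2_phase_zero
  map_add := mulL2_phase_add
  inner_left := inner_mulL2_phase_left
  continuous a := by
    refine continuous_iff_continuousAt.2 fun y => ?_
    have hnorm : ∀ x, ‖mulL2 (memLp_phase x) a‖ ^ 2 = ‖a‖ ^ 2 := fun x => by
      rw [← inner_self_eq_norm_sq (𝕜 := ℂ), ← inner_self_eq_norm_sq (𝕜 := ℂ),
        inner_mulL2_phase_left, ← mulL2_phase_add, neg_add_cancel, mulL2_phase_zero]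
    -- Weak continuity and preservation of norms give strong continuity.
    have h1 : Tendsto (fun x => ‖mulL2 (memLp_phase x) a - mulL2 (memLp_phase y) a‖ ^ 2) (𝓝 y)
        (𝓝 0) := by
      have h2 := (((RCLike.continuous_re (K := ℂ)).comp
        (continuous_inner_mulL2_phase a (mulL2 (memLp_phase y) a))).tendsto y).const_mul 2
      have h3 := h2.const_sub (‖a‖ ^ 2 + ‖a‖ ^ 2)
      simp only [Function.comp_apply, inner_self_eq_norm_sq, hnorm] at h3
      convert h3 using 2 with x
      · rw [@norm_sub_sq ℂ, hnorm, hnorm]; ring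
      · ring
    rw [ContinuousAt, tendsto_iff_norm_sub_tendsto_zero]
    simpa [Real.sqrt_sq (norm_nonneg _)] using h1.sqrt
  tendsto_zero a b := by
    rw [Metric.cobounded_eq_cocompact]
    -- Riemann-Lebesgue is for the forward transform; a reflection passes to the inverse one.
    have h := tendsto_integral_exp_inner_smul_cocompact (fun ξ : E => ⟪a ξ, b ξ⟫)
    have h2 := h.comp (Homeomorph.neg E).isClosedEmbedding.tendsto_cocompact
    refine h2.congr fun x => ?_
    rw [inner_mulL2_phase, Real.fourierInv_eq]
    simp

/-- On `L¹ ∩ L²` the inverse Fourier transform of `L²` is given by the integral formula. -/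
theorem fourierInv_ae_eq_integral (g : Lp ℂ 2 (volume : Measure E)) (hg : Integrable g) :
    (𝓕⁻ g : Lp ℂ 2 (volume : Measure E)) =ᵐ[volume] 𝓕⁻ (g : E → ℂ) := by
  have hcont : Continuous (𝓕⁻ (g : E → ℂ)) :=
    VectorFourier.fourierIntegral_continuous Real.continuous_fourierChar
      (L := -innerₗ E) (by simp only [LinearMap.neg_apply, innerₗ_apply_apply]; fun_prop) hg
  refine ae_eq_of_integral_contDiff_smul_eq
    -- Against a test function, the distributional duality and Fubini move both inverse transforms
    -- onto it.
    ((Lp.memLp _).locallyIntegrable (by norm_num)) hcont.locallyIntegrable fun ψ hψ hψc => ?_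
  have hg₁ : HasCompactSupport (Complex.ofRealCLM ∘ ψ) := hψc.comp_left rfl
  have hg₂ : ContDiff ℝ (⊤ : ℕ∞) (Complex.ofRealCLM ∘ ψ) :=
    Complex.ofRealCLM.contDiff.comp hψ
  let Ψ : 𝓢(E, ℂ) := hg₁.toSchwartzMap hg₂
  have hΨ : ∀ x, Ψ x = (ψ x : ℂ) := fun x => by simp [Ψ]
  have h1 : ((𝓕⁻ g : Lp ℂ 2 (volume : Measure E)) : 𝓢'(E, ℂ)) Ψ =
      (g : 𝓢'(E, ℂ)) (𝓕⁻ Ψ) := by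
    rw [← Lp.fourierInv_toTemperedDistribution_eq, TemperedDistribution.fourierInv_apply]
  rw [Lp.toTemperedDistribution_apply, Lp.toTemperedDistribution_apply] at h1
  have h2 := VectorFourier.integral_fourierIntegral_smul_eq_flip (e := Real.fourierChar)
    (L := -innerₗ E) (μ := volume) (ν := volume) (f := Ψ) (g := (g : E → ℂ))
    Real.continuous_fourierChar (by simp only [LinearMap.neg_apply, innerₗ_apply_apply]; fun_prop)
    Ψ.integrable hg
  have h3 : (-innerₗ E).flip = -innerₗ E := by
    ext x y; simp [real_inner_comm]
  rw [h3] at h2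
  have h4 : ∀ ξ, 𝓕⁻ Ψ ξ = VectorFourier.fourierIntegral Real.fourierChar volume (-innerₗ E) Ψ ξ :=
    fun ξ => by rw [SchwartzMap.fourierInv_coe]; rfl
  simp only [h4] at h1
  rw [h2] at h1
  simp only [hΨ] at h1
  simp only [Complex.real_smul]
  exact h1

theorem fourierInv_phase_mul (g : E → ℂ) (x y : E) :
    𝓕⁻ (fun ξ => phase x ξ * g ξ) y = 𝓕⁻ g (y - x) := by
  rw [Real.fourierInv_eq, Real.fourierInv_eq]
  refine integral_congr_ae (Eventually.of_forall fun ξ => ?_)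
  simp only [phase, Circle.smul_def, smul_eq_mul]
  rw [inner_sub_right, sub_eq_add_neg, AddChar.map_add_eq_mul, Circle.coe_mul, mul_assoc]

/-- The inverse Fourier transform intertwines phases with translations. -/
theorem fourierInv_mulL2_phase (x : E) (g : Lp ℂ 2 (volume : Measure E)) :
    (𝓕⁻ (mulL2 (memLp_phase x) g) : Lp ℂ 2 (volume : Measure E)) =ᵐ[volume]
      fun y => (𝓕⁻ g : Lp ℂ 2 (volume : Measure E)) (y - x) := by
  have hmp : MeasurePreserving (fun y : E => y - x) volume volume :=
    measurePreserving_sub_right volume x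
  let T : Lp ℂ 2 (volume : Measure E) → Lp ℂ 2 (volume : Measure E) :=
    Lp.compMeasurePreserving (fun y : E => y - x) hmp
  have hT : Continuous T := (Lp.isometry_compMeasurePreserving hmp).continuous
  have key : (𝓕⁻ (mulL2 (memLp_phase x) g) : Lp ℂ 2 (volume : Measure E)) = T (𝓕⁻ g) := by
    -- Both sides are continuous in `g`, so Schwartz functions suffice, where the integral formula
    -- is available.
    refine DenseRange.induction_on
      (p := fun g : Lp ℂ 2 (volume : Measure E) =>
        (𝓕⁻ (mulL2 (memLp_phase x) g) : Lp ℂ 2 (volume : Measure E)) = T (𝓕⁻ g))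
      (SchwartzMap.denseRange_toLpCLM (F := ℂ) (p := 2) ENNReal.ofNat_ne_top) g ?_ fun f => ?_
    · refine isClosed_eq ?_ (hT.comp ?_)
      · exact (Lp.fourierTransformₗᵢ E ℂ).symm.continuous.comp (mulL2 (memLp_phase x)).continuous
      · exact (Lp.fourierTransformₗᵢ E ℂ).symm.continuous
    · rw [SchwartzMap.toLpCLM_apply]
      have hf : Integrable (f.toLp 2 : Lp ℂ 2 (volume : Measure E)) :=
        f.integrable.congr (f.coeFn_toLp 2 volume).symm
      have hm := coeFn_mulL2 (memLp_phase x) (f.toLp 2)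
      have hint : Integrable (mulL2 (memLp_phase x) (f.toLp 2)) :=
        (hf.bdd_mul (c := 1) (continuous_phase x).aestronglyMeasurable
          (Eventually.of_forall fun ξ => (norm_phase x ξ).le)).congr hm.symm
      apply Lp.ext
      filter_upwards [fourierInv_ae_eq_integral _ hint, Lp.coeFn_compMeasurePreserving
        (𝓕⁻ (f.toLp 2) : Lp ℂ 2 (volume : Measure E)) hmp,
        hmp.quasiMeasurePreserving.ae_eq_comp (fourierInv_ae_eq_integral _ hf)] with y h1 h2 h3
      rw [h1, h2, h3, Real.fourierInv_congr_ae hm, fourierInv_phase_mul]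
      rfl
  rw [key]
  exact Lp.coeFn_compMeasurePreserving _ hmp

end Fourier

/-! ### Sobolev weights and the parametrization of `H^s` by `L²` -/

section Weights

variable {E : Type*} [NormedAddCommGroup E]

/-- The Bessel weight `(1 + |ξ|²)^{-s/2}`. -/
noncomputable def besselWeight (s : ℝ) (ξ : E) : ℝ := (1 + ‖ξ‖ ^ 2) ^ (-s / 2)

/-- The weight `(2π|ξ|)^s (1 + |ξ|²)^{-s/2}`. -/
noncomputable def rieszWeight (s : ℝ) (ξ : E) : ℝ := (2 * Real.pi * ‖ξ‖) ^ s * besselWeight s ξ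

theorem besselWeight_pos (s : ℝ) (ξ : E) : 0 < besselWeight s ξ :=
  Real.rpow_pos_of_pos (by positivity) _

theorem besselWeight_le_rpow {s : ℝ} (hs : 0 ≤ s) {ξ : E} {t : ℝ} (ht : 0 < t)
    (h : t ^ 2 ≤ 1 + ‖ξ‖ ^ 2) : besselWeight s ξ ≤ t ^ (-s) := by
  calc besselWeight s ξ ≤ (t ^ 2) ^ (-s / 2) :=
        Real.rpow_le_rpow_of_nonpos (by positivity) h (by linarith)
    _ = t ^ (-s) := by
      rw [← Real.rpow_natCast, ← Real.rpow_mul ht.le]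
      congr 1
      push_cast
      ring

theorem besselWeight_le_one {s : ℝ} (hs : 0 ≤ s) (ξ : E) : besselWeight s ξ ≤ 1 := by
  simpa using besselWeight_le_rpow (ξ := ξ) hs one_pos (by simp)

theorem norm_besselWeight_le {s : ℝ} (hs : 0 ≤ s) (ξ : E) : ‖(besselWeight s ξ : ℂ)‖ ≤ 1 := by
  rw [Complex.norm_real, Real.norm_of_nonneg (besselWeight_pos s ξ).le]
  exact besselWeight_le_one hs ξ

theorem norm_rieszWeight_le {s : ℝ} (hs : 0 ≤ s) (ξ : E) :
    ‖(rieszWeight s ξ : ℂ)‖ ≤ (2 * Real.pi) ^ s := by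
  have hw := besselWeight_pos s ξ
  rw [Complex.norm_real, rieszWeight, Real.norm_of_nonneg (by positivity),
    Real.mul_rpow (by positivity) (norm_nonneg _), mul_assoc]
  refine mul_le_of_le_one_right (by positivity) ?_
  rcases (norm_nonneg ξ).eq_or_lt with h | h
  · rw [← h]
    exact mul_le_one₀ (Real.rpow_le_one le_rfl zero_le_one hs) hw.le (besselWeight_le_one hs ξ)
  · calc ‖ξ‖ ^ s * besselWeight s ξ ≤ ‖ξ‖ ^ s * ‖ξ‖ ^ (-s) := by
          gcongr
          exact besselWeight_le_rpow hs h (by linarith)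
      _ = 1 := by rw [← Real.rpow_add h]; simp

/-- Subadditivity of `t ↦ t^s`, which needs `s ≤ 1`. It lets the `L²` and `Ḣ^s` norms of a function
control the norm of its parameter `g`. -/
theorem one_le_besselWeight_add_rieszWeight {s : ℝ} (hs : 0 ≤ s) (hs1 : s ≤ 1) (ξ : E) :
    1 ≤ besselWeight s ξ + rieszWeight s ξ := by
  have h1 : (1 + ‖ξ‖ ^ 2) ^ (s / 2) ≤ 1 + (2 * Real.pi * ‖ξ‖) ^ s := by
    calc (1 + ‖ξ‖ ^ 2) ^ (s / 2) ≤ ((1 + ‖ξ‖) ^ 2) ^ (s / 2) := by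
          gcongr
          nlinarith [norm_nonneg ξ]
      _ = (1 + ‖ξ‖) ^ s := by
          rw [← Real.rpow_natCast, ← Real.rpow_mul (by positivity)]
          congr 1
          push_cast
          ring
      _ ≤ 1 ^ s + ‖ξ‖ ^ s := Real.rpow_add_le_add_rpow zero_le_one (norm_nonneg _) hs hs1
      _ ≤ 1 + (2 * Real.pi * ‖ξ‖) ^ s := by
          rw [Real.one_rpow]
          gcongr
          nlinarith [norm_nonneg ξ, Real.pi_gt_three]
  calc (1 : ℝ) = (1 + ‖ξ‖ ^ 2) ^ (s / 2) * besselWeight s ξ := by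
        rw [besselWeight, ← Real.rpow_add (by positivity)]
        simp [neg_div]
    _ ≤ (1 + (2 * Real.pi * ‖ξ‖) ^ s) * besselWeight s ξ := by
        gcongr
        exact (besselWeight_pos s ξ).le
    _ = besselWeight s ξ + rieszWeight s ξ := by rw [rieszWeight]; ring

theorem continuous_besselWeight (s : ℝ) : Continuous (besselWeight s : E → ℝ) :=
  Continuous.rpow_const (by fun_prop) fun ξ => Or.inl (by positivity)

theorem continuous_rieszWeight {s : ℝ} (hs : 0 ≤ s) : Continuous (rieszWeight s : E → ℝ) :=
  (Continuous.rpow_const (by fun_prop) fun _ => Or.inr hs).mul (continuous_besselWeight s)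

end Weights

theorem hasTemperateGrowth_bessel {E : Type*} [NormedAddCommGroup E] [InnerProductSpace ℝ E]
    (r : ℝ) :
    (fun ξ : E => (((1 + ‖ξ‖ ^ 2) ^ r : ℝ) : ℂ)).HasTemperateGrowth := by fun_prop


section Potential

variable {E : Type*} [NormedAddCommGroup E] [InnerProductSpace ℝ E] [FiniteDimensional ℝ E]
  [MeasurableSpace E] [BorelSpace E]

theorem memLp_besselWeight {s : ℝ} (hs : 0 ≤ s) :
    MemLp (fun ξ : E => (besselWeight s ξ : ℂ)) ∞ volume :=
  memLp_top_of_norm_le (Complex.continuous_ofReal.comp (continuous_besselWeight s)).measurable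
    (norm_besselWeight_le hs)

theorem memLp_rieszWeight {s : ℝ} (hs : 0 ≤ s) :
    MemLp (fun ξ : E => (rieszWeight s ξ : ℂ)) ∞ volume :=
  memLp_top_of_norm_le (Complex.continuous_ofReal.comp (continuous_rieszWeight hs)).measurable
    (norm_rieszWeight_le hs)

/-- The parametrization of `H^s` by `L²`: the inverse Fourier transform of
`(1 + |ξ|²)^{-s/2} g`. -/
noncomputable def besselLp {s : ℝ} (hs : 0 ≤ s) (g : Lp ℂ 2 (volume : Measure E)) :
    Lp ℂ 2 (volume : Measure E) := 𝓕⁻ (mulL2 (memLp_besselWeight hs) g)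

theorem fourier_besselLp {s : ℝ} (hs : 0 ≤ s) (g : Lp ℂ 2 (volume : Measure E)) :
    𝓕 (besselLp hs g) = mulL2 (memLp_besselWeight hs) g :=
  FourierTransform.fourier_fourierInv_eq _

theorem norm_fourierInv_L2 (g : Lp ℂ 2 (volume : Measure E)) :
    ‖(𝓕⁻ g : Lp ℂ 2 (volume : Measure E))‖ = ‖g‖ :=
  (Lp.fourierTransformₗᵢ E ℂ).symm.norm_map g

theorem fourierInv_sub_L2 (f g : Lp ℂ 2 (volume : Measure E)) :
    (𝓕⁻ (f - g) : Lp ℂ 2 (volume : Measure E)) = 𝓕⁻ f - 𝓕⁻ g :=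
  (Lp.fourierTransformₗᵢ E ℂ).symm.map_sub f g

theorem fourierInv_sum_L2 {ι : Type*} (t : Finset ι) (f : ι → Lp ℂ 2 (volume : Measure E)) :
    (𝓕⁻ (∑ i ∈ t, f i) : Lp ℂ 2 (volume : Measure E)) = ∑ i ∈ t, 𝓕⁻ (f i) :=
  map_sum (Lp.fourierTransformₗᵢ E ℂ).symm f t

theorem besselLp_sub {s : ℝ} (hs : 0 ≤ s) (f g : Lp ℂ 2 (volume : Measure E)) :
    besselLp hs (f - g) = besselLp hs f - besselLp hs g := by
  rw [besselLp, map_sub, fourierInv_sub_L2]; rfl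

theorem besselLp_sum {s : ℝ} (hs : 0 ≤ s) {ι : Type*} (t : Finset ι)
    (f : ι → Lp ℂ 2 (volume : Measure E)) :
    besselLp hs (∑ i ∈ t, f i) = ∑ i ∈ t, besselLp hs (f i) := by
  rw [besselLp, map_sum, fourierInv_sum_L2]; rfl

theorem besselLp_phase {s : ℝ} (hs : 0 ≤ s) (x : E) (g : Lp ℂ 2 (volume : Measure E)) :
    besselLp hs (phaseDislocation E x g) =ᵐ[volume] fun y => besselLp hs g (y - x) := by
  rw [besselLp]
  change (𝓕⁻ (mulL2 _ (mulL2 (memLp_phase x) g)) : Lp ℂ 2 (volume : Measure E)) =ᵐ[volume] _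
  rw [mulL2_comm]
  exact fourierInv_mulL2_phase x _

theorem norm_mulL2_le {m : E → ℂ} (hm : MemLp m ∞ (volume : Measure E)) {C : ℝ}
    (hC : ∀ ξ, ‖m ξ‖ ≤ C) (g : Lp ℂ 2 (volume : Measure E)) : ‖mulL2 hm g‖ ≤ C * ‖g‖ := by
  refine Lp.norm_le_mul_norm_of_ae_le_mul ?_
  filter_upwards [coeFn_mulL2 hm g] with ξ h
  rw [h, norm_mul]
  gcongr
  exact hC ξ

theorem norm_le_bessel_add_riesz {s : ℝ} (hs : 0 ≤ s) (hs1 : s ≤ 1)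
    (g : Lp ℂ 2 (volume : Measure E)) :
    ‖g‖ ≤ ‖mulL2 (memLp_besselWeight hs) g‖ + ‖mulL2 (memLp_rieszWeight hs) g‖ := by
  have hm : MemLp (fun ξ : E => ((besselWeight s ξ : ℂ) + (rieszWeight s ξ : ℂ))) ∞ volume :=
    (memLp_besselWeight hs).add (memLp_rieszWeight hs)
  have h1 : mulL2 hm g = mulL2 (memLp_besselWeight hs) g + mulL2 (memLp_rieszWeight hs) g := by
    apply Lp.ext
    filter_upwards [coeFn_mulL2 hm g, coeFn_mulL2 (memLp_besselWeight hs) g,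
      coeFn_mulL2 (memLp_rieszWeight hs) g, Lp.coeFn_add (mulL2 (memLp_besselWeight hs) g)
        (mulL2 (memLp_rieszWeight hs) g)] with ξ h1 h2 h3 h4
    rw [h1, h4, Pi.add_apply, h2, h3, add_mul]
  have h2 : ‖g‖ ≤ 1 * ‖mulL2 hm g‖ := by
    refine Lp.norm_le_mul_norm_of_ae_le_mul ?_
    filter_upwards [coeFn_mulL2 hm g] with ξ h
    have h3 := one_le_besselWeight_add_rieszWeight hs hs1 ξ
    rw [h, norm_mul, one_mul, ← Complex.ofReal_add, Complex.norm_real,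
      Real.norm_of_nonneg (by linarith)]
    exact le_mul_of_one_le_left (norm_nonneg _) h3
  rw [one_mul, h1] at h2
  exact h2.trans (norm_add_le _ _)

theorem toTemperedDistribution_injective :
    Function.Injective fun f : Lp ℂ 2 (volume : Measure E) => (f : 𝓢'(E, ℂ)) := by
  have h := Lp.ker_toTemperedDistributionCLM_eq_bot (F := ℂ) (μ := (volume : Measure E)) (p := 2)
  exact LinearMap.ker_eq_bot.1 h

theorem memSobolev_iff_exists_besselLp {s : ℝ} (hs : 0 ≤ s) (f : Lp ℂ 2 (volume : Measure E)) :
    TemperedDistribution.MemSobolev s 2 (f : 𝓢'(E, ℂ)) ↔ ∃ g, f = besselLp hs g := by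
  have hw : ∀ g : Lp ℂ 2 (volume : Measure E),
      ((mulL2 (memLp_besselWeight hs) g : Lp ℂ 2 (volume : Measure E)) : 𝓢'(E, ℂ)) =
      TemperedDistribution.smulLeftCLM ℂ (fun ξ : E => (((1 + ‖ξ‖ ^ 2) ^ (-s / 2) : ℝ) : ℂ))
        (g : 𝓢'(E, ℂ)) := fun g => by
    rw [mulL2_eq_smul]
    exact Lp.toTemperedDistribution_smul_eq (hasTemperateGrowth_bessel (-s / 2)) _ _
  have hmul : (fun ξ : E => (((1 + ‖ξ‖ ^ 2) ^ (s / 2) : ℝ) : ℂ)) *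
      (fun ξ : E => (((1 + ‖ξ‖ ^ 2) ^ (-s / 2) : ℝ) : ℂ)) = fun _ => 1 := by
    ext ξ
    rw [Pi.mul_apply, ← Complex.ofReal_mul, ← Real.rpow_add (by positivity)]
    simp [neg_div]
  rw [TemperedDistribution.memSobolev_iff_exists_smulLeftCLM_fourier]
  constructor
  · rintro ⟨g, hg⟩
    refine ⟨g, ?_⟩
    have h1 : (𝓕 f : Lp ℂ 2 (volume : Measure E)) = mulL2 (memLp_besselWeight hs) g := by
      apply toTemperedDistribution_injective
      dsimp only
      rw [hw, ← hg, TemperedDistribution.smulLeftCLM_smulLeftCLM_apply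
        (hasTemperateGrowth_bessel _) (hasTemperateGrowth_bessel _), hmul,
        TemperedDistribution.smulLeftCLM_const, one_smul, Lp.fourier_toTemperedDistribution_eq]
    rw [besselLp, ← h1]
    exact (FourierTransform.fourierInv_fourier_eq f).symm
  · rintro ⟨g, rfl⟩
    refine ⟨g, ?_⟩
    rw [Lp.fourier_toTemperedDistribution_eq, fourier_besselLp, hw,
      TemperedDistribution.smulLeftCLM_smulLeftCLM_apply
        (hasTemperateGrowth_bessel _) (hasTemperateGrowth_bessel _), mul_comm, hmul,
        TemperedDistribution.smulLeftCLM_const, one_smul]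

end Potential

section SobolevSpace

variable {d : ℕ} {s : ℝ} {f : EuclideanSpace ℝ (Fin d) → ℂ}

theorem memHs_iff_exists_besselLp (hs : 0 ≤ s) : MemHs s f ↔ ∃ g, f =ᵐ[volume] besselLp hs g := by
  constructor
  · rintro ⟨h, hf⟩
    obtain ⟨g, hg⟩ := (memSobolev_iff_exists_besselLp hs _).1 hf
    exact ⟨g, by rw [← hg]; exact h.coeFn_toLp.symm⟩
  · rintro ⟨g, hg⟩
    have h : MemLp f 2 volume := (memLp_congr_ae hg).2 (Lp.memLp _)
    refine ⟨h, (memSobolev_iff_exists_besselLp hs _).2 ⟨g, ?_⟩⟩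
    exact Lp.ext (h.coeFn_toLp.trans hg)

theorem eLpNorm_eq_of_ae_eq_besselLp (hs : 0 ≤ s)
    {g : Lp ℂ 2 (volume : Measure (EuclideanSpace ℝ (Fin d)))} (hg : f =ᵐ[volume] besselLp hs g) :
    eLpNorm f 2 volume = ‖mulL2 (memLp_besselWeight hs) g‖ₑ := by
  rw [eLpNorm_congr_ae hg, ← Lp.enorm_def, ← ofReal_norm, ← ofReal_norm, besselLp,
    norm_fourierInv_L2]

theorem homSobolevNorm_eq_of_ae_eq_besselLp (hs : 0 ≤ s)
    {g : Lp ℂ 2 (volume : Measure (EuclideanSpace ℝ (Fin d)))} (hg : f =ᵐ[volume] besselLp hs g) :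
    homSobolevNorm s f = ‖mulL2 (memLp_rieszWeight hs) g‖ₑ := by
  have h : MemLp f 2 volume := (memLp_congr_ae hg).2 (Lp.memLp _)
  have h1 : h.toLp f = besselLp hs g := Lp.ext (h.coeFn_toLp.trans hg)
  rw [homSobolevNorm, dif_pos h, h1, fourier_besselLp, Lp.enorm_def]
  refine eLpNorm_congr_ae ?_
  filter_upwards [coeFn_mulL2 (memLp_besselWeight hs) g, coeFn_mulL2 (memLp_rieszWeight hs) g]
    with ξ h1 h2
  rw [h1, h2, rieszWeight, Complex.ofReal_mul, mul_assoc (_ : ℂ)]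

theorem norm_le_of_sobolevNorm_le (hs : 0 ≤ s) (hs1 : s ≤ 1)
    {g : Lp ℂ 2 (volume : Measure (EuclideanSpace ℝ (Fin d)))} (hg : f =ᵐ[volume] besselLp hs g)
    {C : ℝ≥0} (hC : sobolevNorm s f ≤ C) : ‖g‖ ≤ C + C := by
  have hsq : ∀ a b : ℝ≥0∞, a ≤ (a ^ 2 + b ^ 2) ^ (1 / 2 : ℝ) := fun a b => by
    calc a = (a ^ 2) ^ (1 / 2 : ℝ) := by
          rw [← ENNReal.rpow_natCast, ← ENNReal.rpow_mul]; norm_num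
      _ ≤ _ := by gcongr; exact le_self_add
  have h1 : ‖mulL2 (memLp_besselWeight hs) g‖ₑ ≤ C := by
    rw [← eLpNorm_eq_of_ae_eq_besselLp hs hg]
    exact (hsq _ _).trans hC
  have h2 : ‖mulL2 (memLp_rieszWeight hs) g‖ₑ ≤ C := by
    rw [← homSobolevNorm_eq_of_ae_eq_besselLp hs hg]
    refine le_trans ?_ hC
    rw [sobolevNorm, add_comm]
    exact hsq _ _
  rw [enorm_eq_nnnorm, ENNReal.coe_le_coe] at h1 h2
  exact (norm_le_bessel_add_riesz hs hs1 g).trans (add_le_add h1 h2)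

end SobolevSpace

/-! ### Interpolation and dyadic pieces -/

section Interpolation

/-- Integrate `|f|^q ≤ ‖f‖_∞^{q-2} |f|²`. -/
theorem eLpNorm_le_rpow_mul_rpow {α : Type*} [MeasurableSpace α] {μ : Measure α} {f : α → ℂ}
    {q : ℝ} (hq : 2 < q) (hf : eLpNorm f ∞ μ ≠ ∞) :
    eLpNorm f (ENNReal.ofReal q) μ ≤ eLpNorm f 2 μ ^ (2 / q) * eLpNorm f ∞ μ ^ (1 - 2 / q) := by
  have hq0 : 0 < q := by linarith
  rw [eLpNorm_eq_lintegral_rpow_enorm_toReal (by simpa using hq0) ENNReal.ofReal_ne_top,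
    eLpNorm_eq_lintegral_rpow_enorm_toReal (by norm_num) (by norm_num),
    ENNReal.toReal_ofReal hq0.le, ENNReal.toReal_ofNat]
  have h1 : ∫⁻ x, ‖f x‖ₑ ^ q ∂μ ≤ eLpNorm f ∞ μ ^ (q - 2) * ∫⁻ x, ‖f x‖ₑ ^ (2 : ℝ) ∂μ := by
    rw [← lintegral_const_mul' _ _ (ENNReal.rpow_ne_top_of_nonneg (by linarith) hf)]
    refine lintegral_mono_ae ?_
    filter_upwards [enorm_ae_le_eLpNormEssSup f μ] with x hx
    calc ‖f x‖ₑ ^ q = ‖f x‖ₑ ^ (q - 2) * ‖f x‖ₑ ^ (2 : ℝ) := by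
          rw [← ENNReal.rpow_add_of_nonneg _ _ (by linarith) (by norm_num)]; congr 1; ring
      _ ≤ _ := by gcongr; simpa using hx
  calc (∫⁻ x, ‖f x‖ₑ ^ q ∂μ) ^ (1 / q)
      ≤ (eLpNorm f ∞ μ ^ (q - 2) * ∫⁻ x, ‖f x‖ₑ ^ (2 : ℝ) ∂μ) ^ (1 / q) := by gcongr
    _ = ((∫⁻ x, ‖f x‖ₑ ^ (2 : ℝ) ∂μ) ^ (1 / (2 : ℝ))) ^ (2 / q) *
        eLpNorm f ∞ μ ^ (1 - 2 / q) := by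
      rw [ENNReal.mul_rpow_of_nonneg _ _ (by positivity), ← ENNReal.rpow_mul, ← ENNReal.rpow_mul,
        mul_comm]
      congr 2 <;> field_simp

end Interpolation

section Dyadic

variable {E : Type*} [NormedAddCommGroup E]

/-- The index of the dyadic annulus containing a frequency. -/
noncomputable def dyadicIndex (ξ : E) : ℕ := Nat.size ⌊‖ξ‖⌋₊

theorem norm_lt_of_dyadicIndex_le {ξ : E} {k : ℕ} (h : dyadicIndex ξ ≤ k) : ‖ξ‖ < 2 ^ k := by
  have h1 : ⌊‖ξ‖⌋₊ < 2 ^ k := Nat.size_le.1 h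
  have h2 := Nat.lt_of_floor_lt h1
  exact_mod_cast h2

/-- Annulus `0` is the open unit ball, and annulus `k ≥ 1` is `2^{k-1} ≤ |ξ| < 2^k`; the summand `1`
covers `k = 0`. -/
theorem sq_le_of_le_dyadicIndex {ξ : E} {k : ℕ} (h : k ≤ dyadicIndex ξ) :
    ((2 : ℝ) ^ k / 2) ^ 2 ≤ 1 + ‖ξ‖ ^ 2 := by
  rcases k with _ | m
  · norm_num
    nlinarith [norm_nonneg ξ]
  · have h1 : 2 ^ m ≤ ⌊‖ξ‖⌋₊ := Nat.lt_size.1 h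
    have h2 : ((2 ^ m : ℕ) : ℝ) ≤ ‖ξ‖ := (Nat.le_floor_iff (norm_nonneg ξ)).1 h1
    push_cast at h2
    have h3 : (2 : ℝ) ^ (m + 1) / 2 = 2 ^ m := by rw [pow_succ]; ring
    rw [h3]
    have : ((2 : ℝ) ^ m) ^ 2 ≤ ‖ξ‖ ^ 2 := by gcongr
    linarith

theorem measurable_dyadicIndex [MeasurableSpace E] [BorelSpace E] :
    Measurable (dyadicIndex : E → ℕ) :=
  (measurable_of_countable Nat.size).comp (Nat.measurable_floor.comp measurable_norm)

open Classical in
/-- The Bessel weight restricted to a set of dyadic annuli. -/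
noncomputable def dyadicWeight (s : ℝ) (A : Set ℕ) (ξ : E) : ℂ :=
  if dyadicIndex ξ ∈ A then (besselWeight s ξ : ℂ) else 0

theorem measurable_dyadicWeight [MeasurableSpace E] [BorelSpace E] (s : ℝ) (A : Set ℕ) :
    Measurable (dyadicWeight s A : E → ℂ) :=
  Measurable.ite (measurable_dyadicIndex (MeasurableSet.of_discrete (s := A)))
    (Complex.continuous_ofReal.comp (continuous_besselWeight s)).measurable measurable_const

theorem norm_dyadicWeight_le {s : ℝ} (hs : 0 ≤ s) {A : Set ℕ} {k : ℕ} (hA : ∀ i ∈ A, k ≤ i)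
    (ξ : E) : ‖dyadicWeight s A ξ‖ ≤ ((2 : ℝ) ^ k / 2) ^ (-s) := by
  unfold dyadicWeight
  split_ifs with h
  · rw [Complex.norm_real, Real.norm_of_nonneg (besselWeight_pos s ξ).le]
    exact besselWeight_le_rpow hs (by positivity) (sq_le_of_le_dyadicIndex (hA _ h))
  · simp only [norm_zero]
    positivity

theorem conj_dyadicWeight (s : ℝ) (A : Set ℕ) (ξ : E) :
    (starRingEnd ℂ) (dyadicWeight s A ξ) = dyadicWeight s A ξ := by
  unfold dyadicWeight
  split_ifs <;> simp

end Dyadic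

section LittlewoodPaley

variable {E : Type*} [NormedAddCommGroup E] [InnerProductSpace ℝ E] [FiniteDimensional ℝ E]
  [MeasurableSpace E] [BorelSpace E]

local notation "⟪" x ", " y "⟫" => inner ℂ x y

theorem memLp_top_dyadicWeight {s : ℝ} (hs : 0 ≤ s) (A : Set ℕ) :
    MemLp (dyadicWeight s A : E → ℂ) ∞ volume :=
  memLp_top_of_norm_le (measurable_dyadicWeight s A)
    (norm_dyadicWeight_le (k := 0) hs fun _ _ => Nat.zero_le _)

theorem norm_mulL2_dyadicWeight_le {s : ℝ} (hs : 0 ≤ s) {A : Set ℕ} {k : ℕ}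
    (hA : ∀ i ∈ A, k ≤ i) (g : Lp ℂ 2 (volume : Measure E)) :
    ‖mulL2 (memLp_top_dyadicWeight hs A) g‖ ≤ ((2 : ℝ) ^ k / 2) ^ (-s) * ‖g‖ :=
  norm_mulL2_le _ (norm_dyadicWeight_le hs hA) g

/-- The weight is at most a constant on a ball of radius `2^k`; the root of the volume is the
Bernstein factor. -/
theorem eLpNorm_dyadicWeight_le {s : ℝ} (hs : 0 ≤ s) (k : ℕ) :
    eLpNorm (dyadicWeight s {k} : E → ℂ) 2 volume ≤
      ENNReal.ofReal (((2 : ℝ) ^ k / 2) ^ (-s) * (2 ^ k) ^ ((Module.finrank ℝ E : ℝ) / 2) *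
        (volume (Metric.ball (0 : E) 1)).toReal ^ (1 / 2 : ℝ)) := by
  have hB : volume (Metric.ball (0 : E) 1) ≠ ∞ := measure_ball_lt_top.ne
  calc eLpNorm (dyadicWeight s {k} : E → ℂ) 2 volume
      ≤ eLpNorm ((Metric.ball (0 : E) (2 ^ k)).indicator
          fun _ => (((2 : ℝ) ^ k / 2) ^ (-s) : ℝ)) 2 volume := by
        refine eLpNorm_mono fun ξ => ?_
        by_cases hξ : ξ ∈ Metric.ball (0 : E) (2 ^ k)
        · rw [Set.indicator_of_mem hξ, Real.norm_of_nonneg (by positivity)]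
          exact norm_dyadicWeight_le hs (by simp) ξ
        · have : dyadicIndex ξ ≠ k := fun h => hξ (by
            simpa using norm_lt_of_dyadicIndex_le h.le)
          simp [dyadicWeight, this]
    _ = _ := by
        rw [eLpNorm_indicator_const measurableSet_ball (by norm_num) (by norm_num),
          Measure.addHaar_ball_of_pos _ _ (by positivity), mul_assoc,
          ENNReal.ofReal_mul (by positivity), Real.enorm_of_nonneg (by positivity),
          ENNReal.mul_rpow_of_nonneg _ _ (by norm_num), ENNReal.ofReal_mul (by positivity),
          ← ENNReal.ofReal_rpow_of_nonneg ENNReal.toReal_nonneg (by norm_num),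
          ENNReal.ofReal_toReal hB, ENNReal.ofReal_rpow_of_nonneg (by positivity) (by norm_num),
          ← Real.rpow_natCast (_ ^ k), ← Real.rpow_mul (by positivity)]
        norm_num [div_eq_mul_inv]

theorem memLp_two_dyadicWeight {s : ℝ} (hs : 0 ≤ s) (k : ℕ) :
    MemLp (dyadicWeight s {k} : E → ℂ) 2 volume :=
  ⟨(measurable_dyadicWeight s _).aestronglyMeasurable,
    (eLpNorm_dyadicWeight_le hs k).trans_lt ENNReal.ofReal_lt_top⟩

variable (E) in
/-- The `L²` function `1_{D_k} (1 + |ξ|²)^{-s/2}`, where `D_k` is a dyadic annulus. -/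
noncomputable def dyadicLp {s : ℝ} (hs : 0 ≤ s) (k : ℕ) : Lp ℂ 2 (volume : Measure E) :=
  (memLp_two_dyadicWeight hs k).toLp _

theorem norm_dyadicLp_le {s : ℝ} (hs : 0 ≤ s) (k : ℕ) :
    ‖dyadicLp E hs k‖ ≤ ((2 : ℝ) ^ k / 2) ^ (-s) * (2 ^ k) ^ ((Module.finrank ℝ E : ℝ) / 2) *
        (volume (Metric.ball (0 : E) 1)).toReal ^ (1 / 2 : ℝ) := by
  rw [dyadicLp, Lp.norm_toLp]
  exact ENNReal.toReal_le_of_le_ofReal (by positivity) (eLpNorm_dyadicWeight_le hs k)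

/-- The largest matrix coefficient of `g` against a dyadic bump. -/
noncomputable def dyadicSup {s : ℝ} (hs : 0 ≤ s) (k : ℕ) (g : Lp ℂ 2 (volume : Measure E)) : ℝ :=
  ⨆ x, ‖⟪phaseDislocation E x (dyadicLp E hs k), g⟫‖

theorem dyadicSup_nonneg {s : ℝ} (hs : 0 ≤ s) (k : ℕ) (g : Lp ℂ 2 (volume : Measure E)) :
    0 ≤ dyadicSup hs k g := Real.iSup_nonneg fun _ => norm_nonneg _

theorem norm_inner_le_norm_dyadicLp {s : ℝ} (hs : 0 ≤ s) (k : ℕ)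
    (g : Lp ℂ 2 (volume : Measure E)) (x : E) :
    ‖⟪phaseDislocation E x (dyadicLp E hs k), g⟫‖ ≤ ‖dyadicLp E hs k‖ * ‖g‖ :=
  (norm_inner_le_norm _ _).trans_eq (by rw [Dislocation.norm_apply])

theorem dyadicSup_le {s : ℝ} (hs : 0 ≤ s) (k : ℕ) (g : Lp ℂ 2 (volume : Measure E)) :
    dyadicSup hs k g ≤ ‖dyadicLp E hs k‖ * ‖g‖ :=
  ciSup_le (norm_inner_le_norm_dyadicLp hs k g)

/-- The localized function is a product of two `L²` functions, hence integrable, so the integral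
formula turns it into a matrix coefficient. -/
theorem fourierInv_dyadic_ae_eq {s : ℝ} (hs : 0 ≤ s) (k : ℕ)
    (g : Lp ℂ 2 (volume : Measure E)) :
    (𝓕⁻ (mulL2 (memLp_top_dyadicWeight hs {k}) g) : Lp ℂ 2 (volume : Measure E)) =ᵐ[volume]
      fun x => ⟪phaseDislocation E x (dyadicLp E hs k), g⟫ := by
  have h1 : (mulL2 (memLp_top_dyadicWeight hs {k}) g : E → ℂ) =ᵐ[volume]
      fun ξ => ⟪dyadicLp E hs k ξ, g ξ⟫ := by
    filter_upwards [coeFn_mulL2 (memLp_top_dyadicWeight hs {k}) g,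
      (memLp_two_dyadicWeight (E := E) hs k).coeFn_toLp] with ξ h1 h2
    rw [h1, dyadicLp, h2, RCLike.inner_apply, conj_dyadicWeight, mul_comm]
  have hint := (integrable_inner_L2 (dyadicLp E hs k) g).congr h1.symm
  filter_upwards [fourierInv_ae_eq_integral _ hint] with x hx
  rw [hx, Real.fourierInv_congr_ae h1]
  exact (inner_mulL2_phase x _ _).symm

theorem eLpNorm_fourierInv_dyadic_le {s : ℝ} (hs : 0 ≤ s) (k : ℕ) {q : ℝ} (hq : 2 < q)
    {M : ℝ} {g : Lp ℂ 2 (volume : Measure E)} (hg : ‖g‖ ≤ M) :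
    eLpNorm (𝓕⁻ (mulL2 (memLp_top_dyadicWeight hs {k}) g) : Lp ℂ 2 (volume : Measure E))
      (ENNReal.ofReal q) volume ≤
      ENNReal.ofReal ((((2 : ℝ) ^ k / 2) ^ (-s) * M) ^ (2 / q) *
        dyadicSup hs k g ^ (1 - 2 / q)) := by
  have hM : 0 ≤ M := (norm_nonneg g).trans hg
  have hq' : 0 ≤ 1 - 2 / q := by
    rw [sub_nonneg, div_le_one (by linarith)]; exact hq.le
  have hsup : eLpNorm (𝓕⁻ (mulL2 (memLp_top_dyadicWeight hs {k}) g) :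
      Lp ℂ 2 (volume : Measure E)) ∞ volume ≤ ENNReal.ofReal (dyadicSup hs k g) := by
    rw [eLpNorm_congr_ae (fourierInv_dyadic_ae_eq hs k g), eLpNorm_exponent_top]
    refine eLpNormEssSup_le_of_ae_bound (Eventually.of_forall fun x => ?_)
    exact le_ciSup (f := fun x => ‖⟪phaseDislocation E x (dyadicLp E hs k), g⟫‖)
      ⟨_, by rintro _ ⟨y, rfl⟩; exact norm_inner_le_norm_dyadicLp hs k g y⟩ x
  refine (eLpNorm_le_rpow_mul_rpow hq (hsup.trans_lt ENNReal.ofReal_lt_top).ne).trans ?_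
  rw [ENNReal.ofReal_mul (by positivity),
    ← ENNReal.ofReal_rpow_of_nonneg (by positivity) (by positivity),
    ← ENNReal.ofReal_rpow_of_nonneg (dyadicSup_nonneg hs k g) hq']
  gcongr
  rw [← Lp.enorm_def, ← ofReal_norm, norm_fourierInv_L2]
  apply ENNReal.ofReal_le_ofReal
  refine (norm_mulL2_dyadicWeight_le hs (k := k) (by simp) g).trans ?_
  gcongr

theorem mulL2_besselWeight_sub_sum {s : ℝ} (hs : 0 ≤ s) (K : ℕ)
    (g : Lp ℂ 2 (volume : Measure E)) :
    mulL2 (memLp_besselWeight hs) g -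
      ∑ k ∈ Finset.range K, mulL2 (memLp_top_dyadicWeight hs {k}) g =
      mulL2 (memLp_top_dyadicWeight hs (Set.Ici K)) g := by
  induction K with
  | zero =>
    simp only [Finset.range_zero, Finset.sum_empty, sub_zero]
    apply Lp.ext
    filter_upwards [coeFn_mulL2 (memLp_besselWeight hs) g,
      coeFn_mulL2 (memLp_top_dyadicWeight hs (Set.Ici 0)) g] with ξ h1 h2
    rw [h1, h2]
    simp [dyadicWeight]
  | succ K ih =>
    rw [Finset.sum_range_succ, ← sub_sub, ih]
    apply Lp.ext
    filter_upwards [coeFn_mulL2 (memLp_top_dyadicWeight hs (Set.Ici K)) g,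
      coeFn_mulL2 (memLp_top_dyadicWeight hs {K}) g,
      coeFn_mulL2 (memLp_top_dyadicWeight hs (Set.Ici (K + 1))) g,
      Lp.coeFn_sub (mulL2 (memLp_top_dyadicWeight hs (Set.Ici K)) g)
        (mulL2 (memLp_top_dyadicWeight hs {K}) g)] with ξ h1 h2 h3 h4
    rw [h4, Pi.sub_apply, h1, h2, h3, ← sub_mul]
    congr 1
    simp only [dyadicWeight, Set.mem_Ici, Set.mem_singleton_iff]
    rcases lt_trichotomy (dyadicIndex ξ) K with h | h | h
    · rw [if_neg (by lia), if_neg (by lia), if_neg (by lia), sub_zero]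
    · rw [if_pos (by lia), if_pos (by lia), if_neg (by lia), sub_self]
    · rw [if_pos (by lia), if_neg (by lia), if_pos (by lia), sub_zero]

theorem tendsto_sum_fourierInv_dyadic {s : ℝ} (hs : 0 < s) (g : Lp ℂ 2 (volume : Measure E)) :
    Tendsto (fun K => ∑ k ∈ Finset.range K,
      (𝓕⁻ (mulL2 (memLp_top_dyadicWeight hs.le {k}) g) : Lp ℂ 2 (volume : Measure E))) atTop
      (𝓝 (besselLp hs.le g)) := by
  rw [tendsto_iff_norm_sub_tendsto_zero]
  have h1 : Tendsto (fun K : ℕ => ((2 : ℝ) ^ K / 2) ^ (-s) * ‖g‖) atTop (𝓝 (0 * ‖g‖)) := by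
    refine Tendsto.mul_const _ ?_
    exact (tendsto_rpow_neg_atTop hs).comp
      ((tendsto_pow_atTop_atTop_of_one_lt one_lt_two).atTop_div_const two_pos)
  rw [zero_mul] at h1
  refine squeeze_zero (fun _ => norm_nonneg _) (fun K => ?_) h1
  rw [norm_sub_rev, besselLp, ← fourierInv_sum_L2, ← fourierInv_sub_L2, norm_fourierInv_L2,
    mulL2_besselWeight_sub_sum]
  exact norm_mulL2_dyadicWeight_le hs.le (fun _ h => h) g
  exact hs.le

/-- Littlewood-Paley estimate of the `L^q` norm of an `H^s` function. -/
theorem eLpNorm_besselLp_le_tsum {s : ℝ} (hs : 0 < s) {q : ℝ} (hq : 2 < q) {M : ℝ}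
    {g : Lp ℂ 2 (volume : Measure E)} (hg : ‖g‖ ≤ M) :
    eLpNorm (besselLp hs.le g) (ENNReal.ofReal q) volume ≤
      ∑' k, ENNReal.ofReal ((((2 : ℝ) ^ k / 2) ^ (-s) * M) ^ (2 / q) *
        dyadicSup hs.le k g ^ (1 - 2 / q)) := by
  have hq1 : 1 ≤ ENNReal.ofReal q := by
    rw [← ENNReal.ofReal_one]; exact ENNReal.ofReal_le_ofReal (by linarith)
  -- The partial sums converge in `L²`, hence in measure, under which the `L^q` norm is lower
  -- semicontinuous.
  refine eLpNorm_le_of_tendstoInMeasure (Eventually.of_forall fun K => ?_)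
    (tendstoInMeasure_of_tendsto_Lp (tendsto_sum_fourierInv_dyadic hs g))
    fun K => (Lp.memLp _).1
  rw [eLpNorm_congr_ae (Lp.coeFn_finsetSum _ _)]
  refine (eLpNorm_sum_le (fun k _ => (Lp.memLp _).1) hq1).trans ?_
  refine (Finset.sum_le_sum fun k _ => eLpNorm_fourierInv_dyadic_le hs.le k hq hg).trans ?_
  exact ENNReal.sum_le_tsum _

end LittlewoodPaley

/-! ### Smallness of the remainders in subcritical spaces -/

section Smallness

variable {E : Type*} [NormedAddCommGroup E] [InnerProductSpace ℝ E] [FiniteDimensional ℝ E]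
  [MeasurableSpace E] [BorelSpace E]

variable (E) in
/-- In the subcritical range the Littlewood-Paley pieces decay geometrically. -/
theorem exists_summable_dyadic_bound {s q M : ℝ} (hs : 0 ≤ s) (hq : 2 < q) (hM : 0 ≤ M)
    (hsub : (Module.finrank ℝ E : ℝ) / 2 * (1 - 2 / q) < s) :
    ∃ B : ℕ → ℝ, Summable B ∧ ∀ k N, 0 ≤ N → N ≤ ‖dyadicLp E hs k‖ * M →
      (((2 : ℝ) ^ k / 2) ^ (-s) * M) ^ (2 / q) * N ^ (1 - 2 / q) ≤ B k := by
  have hq' : 0 ≤ 1 - 2 / q := by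
    rw [sub_nonneg, div_le_one (by linarith)]; exact hq.le
  set δ : ℝ := (Module.finrank ℝ E : ℝ) / 2 with hδ
  set c : ℝ := (volume (Metric.ball (0 : E) 1)).toReal ^ (1 / 2 : ℝ) with hc
  have hc0 : 0 ≤ c := by positivity
  -- With `δ = dim E / 2`, the exponent of `2^k` is `-s (2/q) + (δ - s)(1 - 2/q) = δ (1 - 2/q) - s`,
  -- negative by `hsub`.
  refine ⟨fun k => (2 ^ s * M) ^ (2 / q) * (2 ^ s * c * M) ^ (1 - 2 / q) *
    ((2 : ℝ) ^ (δ * (1 - 2 / q) - s)) ^ k, ?_, fun k N hN hNk => ?_⟩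
  · refine (summable_geometric_of_lt_one (by positivity) ?_).mul_left _
    exact Real.rpow_lt_one_of_one_lt_of_neg one_lt_two (by linarith)
  · have hk : (0 : ℝ) < 2 ^ k := by positivity
    have h1 : ((2 : ℝ) ^ k / 2) ^ (-s) = (2 ^ k) ^ (-s) * 2 ^ s := by
      rw [Real.div_rpow hk.le (by norm_num), Real.rpow_neg (by norm_num : (0 : ℝ) ≤ 2),
        div_inv_eq_mul]
    have h2 : N ≤ (2 ^ k) ^ (δ - s) * (2 ^ s * c * M) := by
      refine hNk.trans ((mul_le_mul_of_nonneg_right (norm_dyadicLp_le hs k) hM).trans_eq ?_)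
      rw [h1, sub_eq_add_neg, Real.rpow_add hk]
      ring
    calc (((2 : ℝ) ^ k / 2) ^ (-s) * M) ^ (2 / q) * N ^ (1 - 2 / q)
        ≤ ((2 ^ k) ^ (-s) * (2 ^ s * M)) ^ (2 / q) *
          ((2 ^ k) ^ (δ - s) * (2 ^ s * c * M)) ^ (1 - 2 / q) := by
          rw [h1, mul_assoc]
          gcongr
      _ = _ := by
          dsimp only
          rw [Real.mul_rpow (x := (2 ^ k) ^ (-s)) (by positivity) (by positivity),
            Real.mul_rpow (x := (2 ^ k) ^ (δ - s)) (by positivity) (by positivity),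
            ← Real.rpow_mul hk.le, ← Real.rpow_mul hk.le, Real.rpow_pow_comm (by norm_num),
            mul_mul_mul_comm, ← Real.rpow_add hk, mul_comm]
          congr 2
          ring

/-- Vanishing of all dyadic matrix coefficients forces vanishing in subcritical `L^q`. -/
theorem tendsto_limsup_eLpNorm_besselLp {s q M : ℝ} (hs : 0 < s) (hq : 2 < q)
    (hsub : (Module.finrank ℝ E : ℝ) / 2 * (1 - 2 / q) < s)
    {w : ℕ → ℕ → Lp ℂ 2 (volume : Measure E)} (hw : ∀ l, ∀ᶠ n in atTop, ‖w l n‖ ≤ M)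
    {c : ℕ → ℕ → ℝ}
    (hc : ∀ k l, Tendsto (fun n => dyadicSup hs.le k (w l n)) atTop (𝓝 (c k l)))
    (hc0 : ∀ k, Tendsto (c k) atTop (𝓝 0)) :
    Tendsto (fun l => limsup (fun n => eLpNorm (besselLp hs.le (w l n)) (ENNReal.ofReal q) volume)
      atTop) atTop (𝓝 0) := by
  have hq' : 0 < 1 - 2 / q := by
    rw [sub_pos, div_lt_one (by linarith)]; exact hq
  have hM : 0 ≤ M := by
    obtain ⟨n, hn⟩ := (hw 0).exists
    exact (norm_nonneg _).trans hn
  obtain ⟨B, hB, hBk⟩ := exists_summable_dyadic_bound E hs.le hq hM hsub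
  let T : ℕ → ℝ → ℝ := fun k N =>
    (((2 : ℝ) ^ k / 2) ^ (-s) * M) ^ (2 / q) * N ^ (1 - 2 / q)
  have hT0 : ∀ k N, 0 ≤ N → 0 ≤ T k N := fun k N hN => by positivity
  have hTc : ∀ k, Continuous (T k) := fun k =>
    continuous_const.mul (continuous_id.rpow_const fun _ => Or.inr hq'.le)
  have hsup : ∀ k g, ‖g‖ ≤ M → dyadicSup hs.le k g ≤ ‖dyadicLp E hs.le k‖ * M := fun k g hg =>
    (dyadicSup_le hs.le k g).trans (by gcongr)
  have hcnn : ∀ k l, 0 ≤ c k l := fun k l => ge_of_tendsto' (hc k l) fun n =>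
    dyadicSup_nonneg hs.le k _
  have hcle : ∀ k l, c k l ≤ ‖dyadicLp E hs.le k‖ * M := fun k l =>
    le_of_tendsto (hc k l) ((hw l).mono fun n hn => hsup k _ hn)
  have hTB : ∀ k N, 0 ≤ N → N ≤ ‖dyadicLp E hs.le k‖ * M → ‖T k N‖ ≤ B k := fun k N h0 h1 => by
    rw [Real.norm_of_nonneg (hT0 k N h0)]
    exact hBk k N h0 h1
  have hlim : ∀ l, limsup (fun n => eLpNorm (besselLp hs.le (w l n)) (ENNReal.ofReal q) volume)
      atTop ≤ ENNReal.ofReal (∑' k, T k (c k l)) := by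
    intro l
    have h1 : Tendsto (fun n => ∑' k, T k (dyadicSup hs.le k (w l n))) atTop
        (𝓝 (∑' k, T k (c k l))) :=
      tendsto_tsum_of_dominated_convergence hB (fun k => ((hTc k).tendsto _).comp (hc k l))
        ((hw l).mono fun n hn k => hTB k _ (dyadicSup_nonneg hs.le k _) (hsup k _ hn))
    have h2 := (ENNReal.continuous_ofReal.tendsto _).comp h1
    rw [← h2.limsup_eq]
    refine limsup_le_limsup ((hw l).mono fun n hn => ?_)
    refine (eLpNorm_besselLp_le_tsum hs hq hn).trans_eq ?_
    refine (ENNReal.ofReal_tsum_of_nonneg (fun k => hT0 k _ (dyadicSup_nonneg hs.le k _)) ?_).symm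
    exact Summable.of_norm_bounded hB fun k =>
      hTB k _ (dyadicSup_nonneg hs.le k _) (hsup k _ hn)
  have hzero : Tendsto (fun l => ENNReal.ofReal (∑' k, T k (c k l))) atTop (𝓝 0) := by
    have h1 : Tendsto (fun l => ∑' k, T k (c k l)) atTop (𝓝 (∑' k, T k 0)) :=
      tendsto_tsum_of_dominated_convergence hB (fun k => ((hTc k).tendsto _).comp (hc0 k))
        (Eventually.of_forall fun l k => hTB k _ (hcnn k l) (hcle k l))
    -- Here `q > 2` makes the exponent of `N` positive.
    have h2 : ∑' k, T k 0 = 0 := by simp [T, Real.zero_rpow hq'.ne']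
    rw [h2] at h1
    simpa [Function.comp_def] using (ENNReal.continuous_ofReal.tendsto _).comp h1
  exact tendsto_of_tendsto_of_tendsto_of_le_of_le tendsto_const_nhds hzero
    (fun _ => zero_le) hlim

end Smallness

/-! ### The critical exponent and the conclusion -/

/-- Clearing denominators turns `q < 2d/(d-2s)` into the summability condition; for `d = 1`, `s ≥
1/2` that condition is automatic. -/
theorem exists_real_of_lt_twoStar {d : ℕ} (hd : 1 ≤ d) {s : ℝ} (hs0 : 0 < s) (hs1 : s < 1)
    {q : ℝ≥0∞} (hq : 2 < q) (hq' : q < twoStar d s) :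
    ∃ r : ℝ, q = ENNReal.ofReal r ∧ 2 < r ∧ (d : ℝ) / 2 * (1 - 2 / r) < s := by
  have htop : q ≠ ∞ := (hq'.trans_le le_top).ne
  have hr : 2 < q.toReal := by
    rw [← ENNReal.toReal_ofNat 2]
    exact (ENNReal.toReal_lt_toReal (by norm_num) htop).2 hq
  have hcrit : ∀ D : ℝ, 0 < D - 2 * s → q.toReal < 2 * D / (D - 2 * s) →
      D / 2 * (1 - 2 / q.toReal) < s := by
    intro D hD h
    rw [lt_div_iff₀ hD] at h
    have h0 : 0 < q.toReal := by linarith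
    have h1 : D / 2 * (1 - 2 / q.toReal) = (D * q.toReal - 2 * D) / (2 * q.toReal) := by
      field_simp
    rw [h1, div_lt_iff₀ (by positivity)]
    linarith
  have hofReal : ∀ t : ℝ, q < ENNReal.ofReal t → q.toReal < t := fun t h => by
    rwa [ENNReal.lt_ofReal_iff_toReal_lt htop] at h
  refine ⟨q.toReal, (ENNReal.ofReal_toReal htop).symm, hr, ?_⟩
  unfold twoStar at hq'
  split_ifs at hq' with h1 h2
  · subst h1
    refine hcrit _ (by push_cast; linarith) ?_
    have := hofReal _ hq'
    simpa using this
  · subst h1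
    have h3 : 0 < 2 / q.toReal := by positivity
    push_cast
    linarith
  · have hd2 : (2 : ℝ) ≤ d := by exact_mod_cast (by lia : 2 ≤ d)
    exact hcrit _ (by linarith) (hofReal _ hq')

theorem theorem3p1 (d : ℕ) (hd : 1 ≤ d) (s : ℝ) (hs0 : 0 < s) (hs1 : s < 1)
    (v : ℕ → EuclideanSpace ℝ (Fin d) → ℂ)
    (hv : ∀ n, MemHs s (v n))
    (hbdd : ∃ C : ℝ≥0, ∀ n, sobolevNorm s (v n) ≤ C) :
    ∃ (φ : ℕ → ℕ) (x : ℕ → ℕ → EuclideanSpace ℝ (Fin d))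
      (V : ℕ → EuclideanSpace ℝ (Fin d) → ℂ)
      (w : ℕ → ℕ → EuclideanSpace ℝ (Fin d) → ℂ),
      StrictMono φ ∧
      (∀ j, MemHs s (V j)) ∧
      -- pairwise orthogonality of the translation parameters
      (∀ k j, k ≠ j → Tendsto (fun n => ‖x k n - x j n‖) atTop atTop) ∧
      -- decomposition, with remainders in `H^s`
      (∀ l, 1 ≤ l → ∀ n, MemHs s (w l n) ∧
        ∀ y, v (φ n) y = (∑ j ∈ Finset.range l, V j (y - x j n)) + w l n y) ∧
      -- smallness of the remainders
      (∀ q : ℝ≥0∞, 2 < q → q < twoStar d s →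
        Tendsto (fun l => limsup (fun n => eLpNorm (w l n) q volume) atTop) atTop (𝓝 0)) ∧
      -- asymptotic splitting of the `L²` norm
      (∀ l, 1 ≤ l → Tendsto (fun n =>
        (eLpNorm (v (φ n)) 2 volume).toReal ^ 2
          - ((∑ j ∈ Finset.range l, (eLpNorm (V j) 2 volume).toReal ^ 2)
            + (eLpNorm (w l n) 2 volume).toReal ^ 2)) atTop (𝓝 0)) ∧
      -- asymptotic splitting of the `Ḣ^s` norm
      (∀ l, 1 ≤ l → Tendsto (fun n =>
        (homSobolevNorm s (v (φ n))).toReal ^ 2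
          - ((∑ j ∈ Finset.range l, (homSobolevNorm s (V j)).toReal ^ 2)
            + (homSobolevNorm s (w l n)).toReal ^ 2)) atTop (𝓝 0)) := by
  have : Nonempty (Fin d) := ⟨⟨0, hd⟩⟩
  have : Nontrivial (EuclideanSpace ℝ (Fin d)) := inferInstance
  obtain ⟨C, hC⟩ := hbdd
  choose g hg using fun n => (memHs_iff_exists_besselLp hs0.le).1 (hv n)
  have hgC : ∀ n, ‖g n‖ ≤ C + C := fun n => norm_le_of_sobolevNorm_le hs0.le hs1.le (hg n) (hC n)
  have h𝒰 : ((hyperfilter ℕ : Ultrafilter ℕ) : Filter ℕ) ≤ atTop := Nat.hyperfilter_le_atTop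
  let U := phaseDislocation (EuclideanSpace ℝ (Fin d))
  obtain ⟨X, G, W, hW, hX, hpyth, hsmall⟩ := U.exists_profiles h𝒰 hgC
  choose c hc hc0 using fun k => hsmall (dyadicLp (EuclideanSpace ℝ (Fin d)) hs0.le k)
  -- the multipliers whose norms split asymptotically
  let A : Fin 3 → (Lp ℂ 2 (volume : Measure (EuclideanSpace ℝ (Fin d))) →L[ℂ]
      Lp ℂ 2 (volume : Measure (EuclideanSpace ℝ (Fin d)))) :=
    ![ContinuousLinearMap.id ℂ _, mulL2 (memLp_besselWeight hs0.le),
      mulL2 (memLp_rieszWeight hs0.le)]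
  have hA : ∀ i y a, A i (U y a) = U y (A i a) := by
    intro i y a
    fin_cases i
    · rfl
    · exact mulL2_comm _ _ a
    · exact mulL2_comm _ _ a
  obtain ⟨φ, hφ, hlim⟩ := exists_strictMono_tendsto_of_ultrafilter
    (ι := {p : ℕ × ℕ // p.1 ≠ p.2} ⊕ (Fin 3 × ℕ) ⊕ (ℕ × ℕ)) (α := fun _ => ℝ) (hyperfilter ℕ) h𝒰
    (Sum.elim (fun p n => ‖X p.1.1 n - X p.1.2 n‖) (Sum.elim
      (fun p n => ‖A p.1 (g n)‖ ^ 2 -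
          ((∑ j ∈ Finset.range p.2, ‖A p.1 (G j)‖ ^ 2) + ‖A p.1 (W p.2 n)‖ ^ 2))
      (fun p n => dyadicSup hs0.le p.1 (W p.2 n))))
    (Sum.elim (fun _ => atTop) (Sum.elim (fun _ => 𝓝 0) (fun p => 𝓝 (c p.1 p.2)))) (by
      rintro (p | p | p) <;> simp only [Sum.elim_inl, Sum.elim_inr] <;> infer_instance) (by
      rintro (p | p | p)
      · exact hX _ _ p.2
      · exact hpyth (A p.1) (hA p.1) p.2
      · exact hc p.1 p.2)
  have hsplit : ∀ i l, Tendsto (fun n => ‖A i (g (φ n))‖ ^ 2 -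
      ((∑ j ∈ Finset.range l, ‖A i (G j)‖ ^ 2) + ‖A i (W l (φ n))‖ ^ 2)) atTop (𝓝 0) :=
    fun i l => hlim (Sum.inr (Sum.inl (i, l)))
  let V : ℕ → EuclideanSpace ℝ (Fin d) → ℂ := fun j => besselLp hs0.le (G j)
  -- Defined pointwise so that the decomposition holds at every point; its Fourier description holds
  -- only almost everywhere.
  let w : ℕ → ℕ → EuclideanSpace ℝ (Fin d) → ℂ := fun l n y =>
    v (φ n) y - ∑ j ∈ Finset.range l, V j (y - X j (φ n))
  have hV : ∀ j, V j =ᵐ[volume] besselLp hs0.le (G j) := fun j => EventuallyEq.rfl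
  have hw : ∀ l n, w l n =ᵐ[volume] besselLp hs0.le (W l (φ n)) := by
    intro l n
    rw [hW, besselLp_sub, besselLp_sum]
    filter_upwards [hg (φ n), Lp.coeFn_sub (besselLp hs0.le (g (φ n)))
      (∑ j ∈ Finset.range l, besselLp hs0.le (U (X j (φ n)) (G j))),
      Lp.coeFn_finsetSum (Finset.range l) fun j => besselLp hs0.le (U (X j (φ n)) (G j)),
      ae_all_iff.2 fun j => besselLp_phase hs0.le (X j (φ n)) (G j)] with y h1 h2 h3 h4
    rw [h2, Pi.sub_apply, h3]
    simp only [w, V, h1, Finset.sum_apply]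
    congr 1
    exact Finset.sum_congr rfl fun j _ => (h4 j).symm
  have hWM : ∀ l, ∀ᶠ n in atTop, ‖W l (φ n)‖ ≤ C + C + 1 := by
    intro l
    -- The splitting for the identity multiplier gives eventually `‖W l‖² < (2C)² + 1 ≤ (2C + 1)²`,
    -- a bound uniform in `l`.
    filter_upwards [(hsplit 0 l).eventually_const_lt (show (-1 : ℝ) < 0 by norm_num)] with n hn
    have h1 : -1 < ‖g (φ n)‖ ^ 2 -
      ((∑ j ∈ Finset.range l, ‖G j‖ ^ 2) + ‖W l (φ n)‖ ^ 2) := hn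
    have h2 : 0 ≤ ∑ j ∈ Finset.range l, ‖G j‖ ^ 2 := Finset.sum_nonneg fun _ _ => sq_nonneg _
    have h3 : ‖g (φ n)‖ ^ 2 ≤ ((C : ℝ) + C) ^ 2 := by gcongr; exact hgC _
    have h4 : (0 : ℝ) ≤ C := C.2
    exact abs_le_of_sq_le_sq' (by nlinarith) (by positivity) |>.2
  refine ⟨φ, fun j n => X j (φ n), V, w, hφ,
    fun j => (memHs_iff_exists_besselLp hs0.le).2 ⟨_, hV j⟩,
    fun k j hkj => hlim (Sum.inl ⟨(k, j), hkj⟩),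
    fun l _ n => ⟨(memHs_iff_exists_besselLp hs0.le).2 ⟨_, hw l n⟩, fun y => by simp [w]⟩,
    fun q hq hq' => ?_, fun l _ => ?_, fun l _ => ?_⟩
  · obtain ⟨r, rfl, hr, hsub⟩ := exists_real_of_lt_twoStar hd hs0 hs1 hq hq'
    simp only [eLpNorm_congr_ae (hw _ _)]
    exact tendsto_limsup_eLpNorm_besselLp hs0 hr (by simpa using hsub)
      (w := fun l n => W l (φ n)) hWM (fun k l => hlim (Sum.inr (Sum.inr (k, l)))) hc0
  · simp only [eLpNorm_eq_of_ae_eq_besselLp hs0.le (hV _), toReal_enorm,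
      eLpNorm_eq_of_ae_eq_besselLp hs0.le (hw _ _), eLpNorm_eq_of_ae_eq_besselLp hs0.le (hg _)]
    exact hsplit 1 l
  · simp only [homSobolevNorm_eq_of_ae_eq_besselLp hs0.le (hV _), toReal_enorm,
      homSobolevNorm_eq_of_ae_eq_besselLp hs0.le (hw _ _),
      homSobolevNorm_eq_of_ae_eq_besselLp hs0.le (hg _)]
    exact hsplit 2 l
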